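/- For a function $f$ defined on the critical line, the value $f(B)$ of the Bernoulli operator $B$ is $$f(B):=\int_0^\infty\bigl(f(\tfrac12+it)+f(\tfrac12-it)\bigr)\,\frac{\pi}{2\cosh^2(\pi t)}\,dt$$ whenever this integral converges absolutely (so $B^n=B_n$, the Bernoulli numbers with $B_1=\tfrac12$, and $f(1-B)=f(B)$). For a meromorphic function $f$ whose poles are nonzero integers, $f(Bs)$ denotes the value at $B$ of $z\mapsto f(zs)$ when $|s-1|<1$ or $|s+1|<1$, and its analytic continuation in $s$ in the remaining part of the half-planes $\operatorname{Re}s>0$ and $\operatorname{Re}s<0$. Let $\Pi(z)=\Gamma(z+1)$ and let $\gamma$ be Euler's constant. Then the values $\frac{\zeta'(B)}{\zeta(B)}$, $Bs\frac{\Pi'(Bs)}{\Pi(Bs)}$ and $\frac{B\pi s}{2}\frac{\cos \pi Bs}{\sin\pi Bs}$ exist (the last two for all complex $s$ with $\operatorname{Re}s\ne0$, as analytic functions of $s$), and for all complex $s$ with $\operatorname{Re}s\neq 0$ $$-s\,\frac{\zeta'(B)}{\zeta(B)}=Bs\,\frac{\Pi'(Bs)}{\Pi(Bs)}-\frac{1+s+s\log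 2\pi}{2}+\frac{B\pi s}{2}\,\frac{\cos\pi Bs}{\sin\pi Bs}-\frac{\pi^2}{16}\,s .$$ At $s=1$ one has $B\frac{\Pi'(B)}{\Pi(B)}=\frac14-\frac{\gamma}{2}$ and $\frac{\pi B}{2}\frac{\cos\pi B}{\sin\pi B}=\frac14$, and the identity gives $$\frac{\zeta'(B)}{\zeta(B)}=\frac{1+\gamma+\log 2\pi}{2}+\frac{\pi^2}{16}.$$ -/

import Mathlib

/-!
The Bernoulli operator `B` (the Bernoulli umbra with `B₁ = 1/2`) as the random point
`1/2 + i L` of the critical line, where `L` has density `(π/2) sech²(π t)`.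
-/

namespace BernoulliOperator

open Complex MeasureTheory Set Filter Topology

/-- The probability density `(π / 2) sech² (π t)` on the real line. -/
noncomputable def bernoulliDensity (t : ℝ) : ℝ := Real.pi / (2 * Real.cosh (Real.pi * t) ^ 2)

/-- `HasBernoulliValue f v`: the Bernoulli operator function `f (B)` has the value `v`, i.e.
`∫ f (1/2 + i t) (π / 2) sech² (π t) dt = v`. The integral is taken in the sense of the rule
`f (1 - B) = f (B)`, pairing `1/2 + i t` with `1 - (1/2 + i t) = 1/2 - i t`. For an `f` that is
integrable on the line this is the ordinary integral (see `hasBernoulliValue_of_integrable`);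
for an `f` with poles on the line that cancel under the pairing it is the principal value.
On powers the operator gives `B ^ n = Bₙ`, see `hasBernoulliValue_pow`. -/
def HasBernoulliValue (f : ℂ → ℂ) (v : ℂ) : Prop :=
  IntegrableOn (fun t : ℝ => (f (1 / 2 + t * I) + f (1 / 2 - t * I)) * (bernoulliDensity t : ℂ))
      (Ioi 0) ∧
    ∫ t in Ioi (0 : ℝ), (f (1 / 2 + t * I) + f (1 / 2 - t * I)) * (bernoulliDensity t : ℂ) = v

/-- `HasBernoulliFamily f F`: `F s` is the value of `f (B s)` as an analytic function of the
parameter `s`, for a meromorphic `f` whose poles are nonzero integers. As long as `s` lies in one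
of the discs `|s - 1| < 1`, `|s + 1| < 1`, no pole `k / s` (`k` a nonzero integer) of `z ↦ f (z s)`
lies in the strip `|Re z| ≤ 1/2`, and `F s` is the Bernoulli value of that function. In the rest of
the half-planes `Re s > 0` and `Re s < 0`, `F` is the (unique) analytic continuation. -/
structure HasBernoulliFamily (f F : ℂ → ℂ) : Prop where
  differentiableOn : DifferentiableOn ℂ F {s : ℂ | s.re ≠ 0}
  hasBernoulliValue : ∀ s : ℂ, ‖s - 1‖ < 1 ∨ ‖s + 1‖ < 1 →
    HasBernoulliValue (fun z => f (z * s)) (F s)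

/-- Gauss's function `Π (z) = ∫₀^∞ e^{-x} x^z dx = Γ (z + 1)`. -/
noncomputable def factorialPi (z : ℂ) : ℂ := Complex.Gamma (z + 1)

theorem bernoulliDensity_neg (t : ℝ) : bernoulliDensity (-t) = bernoulliDensity t := by
  simp [bernoulliDensity]

theorem continuous_bernoulliDensity : Continuous bernoulliDensity := by
  unfold bernoulliDensity
  have : ∀ t : ℝ, 2 * Real.cosh (Real.pi * t) ^ 2 ≠ 0 := fun t => by
    have := Real.cosh_pos (Real.pi * t); positivity
  fun_prop (disch := exact this _)

theorem bernoulliDensity_nonneg (t : ℝ) : 0 ≤ bernoulliDensity t := by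
  unfold bernoulliDensity; have := Real.pi_pos; positivity

theorem bernoulliDensity_le (t : ℝ) : bernoulliDensity t ≤ 2 * Real.pi * Real.exp (-(2 * t)) := by
  unfold bernoulliDensity
  have hp := Real.pi_gt_three
  by_cases ht : 0 ≤ t
  · have h1 : Real.exp t / 2 ≤ Real.cosh (Real.pi * t) := by
      rw [Real.cosh_eq]
      have : Real.exp t ≤ Real.exp (Real.pi * t) := Real.exp_le_exp.2 (by nlinarith)
      have := Real.exp_pos (-(Real.pi * t))
      linarith
    have h2 : (Real.exp t / 2) ^ 2 ≤ Real.cosh (Real.pi * t) ^ 2 := by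
      have := Real.exp_pos t
      gcongr
    have h3 : Real.exp (-(2*t)) * (Real.exp t)^2 = 1 := by
      rw [← Real.exp_nat_mul, ← Real.exp_add]; simp
    rw [div_le_iff₀ (by have := Real.cosh_pos (Real.pi * t); positivity)]
    have he := Real.exp_pos (-(2*t))
    calc Real.pi = Real.pi * (Real.exp (-(2*t)) * (Real.exp t)^2) := by rw [h3, mul_one]
      _ = 2 * Real.pi * Real.exp (-(2*t)) * (2 * (Real.exp t / 2)^2) := by ring
      _ ≤ _ := by gcongr
  · have h1 := Real.one_le_cosh (Real.pi * t)
    have : (1:ℝ) ≤ Real.cosh (Real.pi * t) ^ 2 := one_le_pow₀ h1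
    have h2 : (1:ℝ) ≤ Real.exp (-(2*t)) := Real.one_le_exp (by linarith)
    rw [div_le_iff₀ (by linarith)]
    nlinarith [mul_le_mul h2 this (by norm_num) (by positivity)]

theorem integrable_pow_mul (a : ℂ) (n : ℕ) :
    Integrable (fun t : ℝ => (a + t * I) ^ n * (bernoulliDensity t : ℂ)) := by
  have key : ∀ b c: ℂ, IntegrableOn (fun t : ℝ => (b + t * c) ^ n * (bernoulliDensity t : ℂ)) (Ioi 0) := by
    intro b c
    have hc : Continuous (fun t : ℝ => (b + t * c) ^ n * (bernoulliDensity t : ℂ)) := by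
      have := continuous_bernoulliDensity
      fun_prop
    have hc2 : Continuous (fun t : ℝ => (‖b‖ + t * ‖c‖) ^ n * bernoulliDensity t) := by
      have := continuous_bernoulliDensity
      fun_prop
    have h : IntegrableOn (fun t : ℝ => (‖b‖ + t * ‖c‖) ^ n * bernoulliDensity t) (Ioi 0) := by
      refine integrable_of_isBigO_exp_neg (b := 1) one_pos hc2.continuousOn ?_
      have h1 : (fun t : ℝ => (‖b‖ + t * ‖c‖)) =O[atTop] fun t => t := by
        refine Asymptotics.IsBigO.add ?_ ?_
        · exact (Asymptotics.isLittleO_const_id_atTop _).isBigO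
        · simpa [mul_comm] using (Asymptotics.isBigO_refl (fun t : ℝ => t) atTop).const_mul_left ‖c‖
      have h2 := (h1.pow n).trans (isLittleO_pow_exp_pos_mul_atTop n one_pos).isBigO
      have h3 : bernoulliDensity =O[atTop] fun t => Real.exp (-(2*t)) := by
        refine Asymptotics.IsBigO.of_bound (2 * Real.pi) (Eventually.of_forall fun t => ?_)
        rw [Real.norm_of_nonneg (bernoulliDensity_nonneg t), Real.norm_of_nonneg (Real.exp_pos _).le]
        exact bernoulliDensity_le t
      refine (h2.mul h3).congr_right fun t => ?_
      rw [← Real.exp_add]; congr 1; ring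
    refine h.mono' hc.aestronglyMeasurable ?_
    filter_upwards [ae_restrict_mem measurableSet_Ioi] with t ht
    rw [norm_mul, norm_pow, norm_real, Real.norm_of_nonneg (bernoulliDensity_nonneg t)]
    gcongr
    · exact bernoulliDensity_nonneg t
    · refine (norm_add_le _ _).trans ?_
      simp [abs_of_pos (mem_Ioi.1 ht)]
  rw [← integrableOn_univ, ← Iic_union_Ioi (a := (0:ℝ))]
  refine IntegrableOn.union ?_ (key a I)
  have := key a (-I)
  rw [← neg_zero, ← integrableOn_Ici_iff_integrableOn_Ioi] at this
  have h2 := this.comp_neg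
  simp only [neg_zero] at h2 ⊢
  refine (integrableOn_congr_fun ?_ measurableSet_Iic).1 (by simpa using h2)
  intro t _
  simp [bernoulliDensity_neg]


theorem hasBernoulliValue_of_integrable {f : ℂ → ℂ}
    (h : Integrable (fun t : ℝ => f (1 / 2 + t * I) * (bernoulliDensity t : ℂ))) :
    HasBernoulliValue f (∫ t : ℝ, f (1 / 2 + t * I) * (bernoulliDensity t : ℂ)) := by
  have hn : Integrable (fun t : ℝ => f (1 / 2 - t * I) * (bernoulliDensity t : ℂ)) := by
    simpa [bernoulliDensity_neg, sub_eq_add_neg] using h.comp_neg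
  have e : (fun t : ℝ => (f (1 / 2 + t * I) + f (1 / 2 - t * I)) * (bernoulliDensity t : ℂ)) =
      fun t : ℝ => f (1 / 2 + t * I) * (bernoulliDensity t : ℂ) +
        f (1 / 2 - t * I) * (bernoulliDensity t : ℂ) := by
    ext t; ring
  refine ⟨?_, ?_⟩
  · rw [e]; exact h.integrableOn.add hn.integrableOn
  · rw [e, integral_add h.integrableOn hn.integrableOn,
      ← intervalIntegral.integral_Iic_add_Ioi h.integrableOn h.integrableOn (b := 0), add_comm]
    congr 1
    have := integral_comp_neg_Ioi (0:ℝ) (fun t : ℝ => f (1 / 2 + t * I) * (bernoulliDensity t : ℂ))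
    simpa [bernoulliDensity_neg, sub_eq_add_neg] using this

theorem integral_bernoulliDensity : ∫ t : ℝ, bernoulliDensity t = 1 := by
  have hd : ∀ t : ℝ, HasDerivAt (fun t : ℝ => Real.tanh (Real.pi * t) / 2) (bernoulliDensity t) t := by
    intro t
    have h0 := Real.cosh_pos (Real.pi * t)
    have h1 : HasDerivAt (fun t : ℝ => Real.pi * t) Real.pi t := by
      simpa using (hasDerivAt_id t).const_mul Real.pi
    have h2 := ((h1.sinh.div h1.cosh h0.ne').div_const 2)
    have h3 : (fun t : ℝ => Real.tanh (Real.pi * t) / 2) =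
      fun t => (Real.sinh (Real.pi * t) / Real.cosh (Real.pi * t)) / 2 := by
      ext t; rw [Real.tanh_eq_sinh_div_cosh]
    rw [h3]
    refine h2.congr_deriv ?_
    unfold bernoulliDensity
    have := Real.cosh_sq (Real.pi * t)
    field_simp
    linear_combination this
  have hi : Integrable bernoulliDensity := by
    have := (integrable_pow_mul 0 0).re
    simpa using this
  have ht : Tendsto (fun x : ℝ => Real.tanh x) atTop (𝓝 1) := by
    have h1 : Tendsto (fun x : ℝ => Real.exp (-(2 * x))) atTop (𝓝 0) :=
      Real.tendsto_exp_neg_atTop_nhds_zero.comp (tendsto_id.const_mul_atTop (by norm_num))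
    have h2 : Tendsto (fun x : ℝ => (1 - Real.exp (-(2 * x))) / (1 + Real.exp (-(2 * x)))) atTop
        (𝓝 ((1 - 0) / (1 + 0))) := (h1.const_sub 1).div (h1.const_add 1) (by norm_num)
    simp only [sub_zero, add_zero, div_one] at h2
    refine h2.congr fun x => ?_
    rw [Real.tanh_eq_sinh_div_cosh, Real.sinh_eq, Real.cosh_eq]
    have e : Real.exp (-(2*x)) = Real.exp (-x) * Real.exp (-x) := by rw [← Real.exp_add]; ring_nf
    have e2 : Real.exp x * Real.exp (-x) = 1 := by rw [← Real.exp_add]; simp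
    have := Real.exp_pos x
    have := Real.exp_pos (-x)
    rw [div_eq_div_iff (by positivity) (by positivity), e]
    linear_combination (-Real.exp (-x)) * e2
  have hmul : Tendsto (fun t : ℝ => Real.pi * t) atTop atTop :=
    tendsto_id.const_mul_atTop Real.pi_pos
  have htop : Tendsto (fun t : ℝ => Real.tanh (Real.pi * t) / 2) atTop (𝓝 (1 / 2)) :=
    (ht.comp hmul).div_const 2
  have hbot : Tendsto (fun t : ℝ => Real.tanh (Real.pi * t) / 2) atBot (𝓝 (-(1 / 2))) := by
    have := (htop.comp tendsto_neg_atBot_atTop).neg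
    refine this.congr fun x => ?_
    simp [Real.tanh_neg, neg_div]
  rw [integral_of_hasDerivAt_of_tendsto hd hi hbot htop]
  norm_num

theorem sinh_le_norm_sin (z : ℂ) : |Real.sinh z.im| ≤ ‖Complex.sin z‖ := by
  have h := abs_norm_sub_norm_le (Complex.exp (-z * I)) (Complex.exp (z * I))
  rw [Complex.sin, norm_div, norm_mul, Complex.norm_I, mul_one, Real.sinh_eq]
  simp only [Complex.norm_exp] at h
  simp at h
  rw [abs_div]
  simp
  linarith

theorem exists_kernel (n : ℕ) : ∃ H : ℂ → ℂ,
    (∀ z : ℂ, z ≠ 0 → H z = z ^ (n + 2) / Complex.sin (Real.pi * z) ^ 2) ∧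
    (∀ z : ℂ, |z.re| ≤ 1 / 2 → DifferentiableAt ℂ H z) := by
  set S : ℂ → ℂ := fun z => Complex.sin (Real.pi * z) with hS
  have hSd : Differentiable ℂ S := by fun_prop
  set g : ℂ → ℂ := dslope S 0 with hg
  have hgd : Differentiable ℂ g := by
    rw [← differentiableOn_univ]
    exact (Complex.differentiableOn_dslope univ_mem).2 hSd.differentiableOn
  have hpi : (Real.pi : ℂ) ≠ 0 := by exact_mod_cast Real.pi_ne_zero
  have hg1 : ∀ z : ℂ, z ≠ 0 → g z = S z / z := by
    intro z hz
    rw [hg, dslope_of_ne _ hz, slope_def_field]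
    simp [hS]
  have hg0 : g 0 = Real.pi := by
    rw [hg, dslope_same]
    have : HasDerivAt S (Complex.cos (Real.pi * 0) * Real.pi) 0 := by
      have h1 : HasDerivAt (fun z : ℂ => (Real.pi : ℂ) * z) Real.pi 0 := by
        simpa using (hasDerivAt_id (0:ℂ)).const_mul (Real.pi : ℂ)
      exact h1.csin
    rw [this.deriv]; simp
  have hne : ∀ z : ℂ, |z.re| ≤ 1 / 2 → g z ≠ 0 := by
    intro z hz
    by_cases h0 : z = 0
    · rw [h0, hg0]; exact hpi
    · rw [hg1 z h0]
      refine div_ne_zero ?_ h0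
      rw [hS]
      simp only
      intro hs
      rw [Complex.sin_eq_zero_iff] at hs
      obtain ⟨k, hk⟩ := hs
      have hzk : z = k := by
        rw [mul_comm] at hk; exact mul_right_cancel₀ hpi hk
      rw [hzk] at hz h0
      simp at hz h0
      have : (1:ℝ) ≤ |(k:ℝ)| := by exact_mod_cast Int.one_le_abs h0
      linarith
  refine ⟨fun z => z ^ n / g z ^ 2, ?_, ?_⟩
  · intro z hz
    simp only [hg1 z hz, hS]
    rw [div_pow, div_div_eq_mul_div]; ring
  · intro z hz
    exact (differentiableAt_id.pow n).div ((hgd z).pow 2) (pow_ne_zero 2 (hne z hz))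

theorem integral_shift (n : ℕ) :
    ∫ t : ℝ, (1 / 2 + t * I : ℂ) ^ (n + 2) * (bernoulliDensity t : ℂ) =
      ∫ t : ℝ, (-(1 / 2) + t * I : ℂ) ^ (n + 2) * (bernoulliDensity t : ℂ) := by
  obtain ⟨H, hH, hHd⟩ := exists_kernel n
  have hpi : (Real.pi : ℂ) ≠ 0 := by exact_mod_cast Real.pi_ne_zero
  have hvert : ∀ a : ℂ, a = 1 / 2 ∨ a = -(1 / 2) → ∀ t : ℝ,
      (a + t * I) ^ (n + 2) * (bernoulliDensity t : ℂ) = (Real.pi / 2) * H (a + t * I) := by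
    intro a ha t
    have hne : a + t * I ≠ 0 := by
      intro h
      have := congrArg Complex.re h
      rcases ha with rfl | rfl <;> norm_num at this
    have hsq : Complex.sin (Real.pi * (a + t * I)) ^ 2 = Complex.cosh (Real.pi * t) ^ 2 := by
      rcases ha with rfl | rfl
      · have : (Real.pi : ℂ) * (1 / 2 + t * I) = (Real.pi * t) * I + Real.pi / 2 := by ring
        rw [this, Complex.sin_add_pi_div_two, Complex.cos_mul_I]
      · have : (Real.pi : ℂ) * (-(1 / 2) + t * I) = (Real.pi * t) * I - Real.pi / 2 := by ring
        rw [this, Complex.sin_sub_pi_div_two, Complex.cos_mul_I, neg_sq]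
    rw [hH _ hne, hsq, bernoulliDensity]
    push_cast
    ring
  have hint : ∀ a : ℂ, a = 1 / 2 ∨ a = -(1 / 2) → Integrable (fun t : ℝ => H (a + t * I)) := by
    intro a ha
    have h := (integrable_pow_mul a (n + 2)).const_mul ((Real.pi / 2 : ℂ)⁻¹)
    refine h.congr (Eventually.of_forall fun t => ?_)
    simp only [hvert a ha t]
    field_simp
  simp_rw [hvert _ (Or.inl rfl), hvert _ (Or.inr rfl)]
  rw [integral_const_mul, integral_const_mul]
  congr 1
  have hrect : ∀ T : ℝ, (∫ y : ℝ in (-T)..T, H (1 / 2 + y * I)) - (∫ y : ℝ in (-T)..T, H (-(1 / 2) + y * I)) =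
      I * ((∫ x : ℝ in (-(1 / 2) : ℝ)..(1 / 2), H (x + ((-T : ℝ) : ℂ) * I)) -
        ∫ x : ℝ in (-(1 / 2) : ℝ)..(1 / 2), H (x + (T : ℂ) * I)) := by
    intro T
    have h := Complex.integral_boundary_rect_eq_zero_of_differentiableOn H ⟨-(1 / 2), -T⟩ ⟨1 / 2, T⟩ (by
      intro z hz
      refine (hHd z ?_).differentiableWithinAt
      have := hz.1
      simp only [mem_preimage] at this
      rw [uIcc_of_le (by norm_num)] at this
      exact abs_le.2 this)
    simp only [smul_eq_mul] at h
    push_cast at h ⊢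
    have hI : I * I = -1 := I_mul_I
    linear_combination (-I) * h + ((∫ y : ℝ in (-T)..T, H (1 / 2 + y * I)) - (∫ y : ℝ in (-T)..T, H (-(1 / 2) + y * I))) * hI
  have hhor : ∀ σ : ℝ, |σ| = 1 → Tendsto (fun T : ℝ => ∫ x : ℝ in (-(1 / 2) : ℝ)..(1 / 2), H (x + ((σ * T : ℝ) : ℂ) * I))
      atTop (𝓝 0) := by
    intro σ hσ
    have hlim : Tendsto (fun T : ℝ => (16 * 2 ^ (n + 2)) * (T ^ (n + 2) * Real.exp (-T))) atTop (𝓝 0) := by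
      simpa using (Real.tendsto_pow_mul_exp_neg_atTop_nhds_zero (n + 2)).const_mul (16 * 2 ^ (n + 2))
    refine squeeze_zero_norm' ?_ hlim
    filter_upwards [eventually_ge_atTop (1 : ℝ)] with T hT
    have hb : ∀ x ∈ uIoc (-(1 / 2) : ℝ) (1 / 2), ‖H (x + ((σ * T : ℝ) : ℂ) * I)‖ ≤
        (16 * 2 ^ (n + 2)) * (T ^ (n + 2) * Real.exp (-T)) := by
      intro x hx
      rw [uIoc_of_le (by norm_num)] at hx
      have hx2 : |x| ≤ 1 / 2 := abs_le.2 ⟨hx.1.le, hx.2⟩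
      set z : ℂ := x + ((σ * T : ℝ) : ℂ) * I with hz
      have him : z.im = σ * T := by simp [hz]
      have hTa : |σ * T| = T := by rw [abs_mul, hσ, one_mul, abs_of_pos (by linarith)]
      have hz0 : z ≠ 0 := by
        intro h
        rw [h] at him
        rw [← him] at hTa
        simp at hTa; linarith
      have hnz : ‖z‖ ≤ 2 * T := by
        calc ‖z‖ ≤ ‖(x : ℂ)‖ + ‖((σ * T : ℝ) : ℂ) * I‖ := norm_add_le _ _
          _ = |x| + T := by
              rw [norm_mul, norm_I, mul_one, norm_real, norm_real, Real.norm_eq_abs, Real.norm_eq_abs, hTa]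
          _ ≤ 2 * T := by linarith
      have hs : Real.exp T / 4 ≤ ‖Complex.sin (Real.pi * z)‖ := by
        refine le_trans ?_ (sinh_le_norm_sin _)
        have : ((Real.pi : ℂ) * z).im = Real.pi * (σ * T) := by simp [him]
        rw [this, Real.abs_sinh, abs_mul, hTa, abs_of_pos Real.pi_pos]
        have h1 : Real.sinh T ≤ Real.sinh (Real.pi * T) :=
          Real.sinh_le_sinh.2 (by nlinarith [Real.pi_gt_three])
        have h2 : Real.exp T / 4 ≤ Real.sinh T := by
          rw [Real.sinh_eq]
          have := Real.add_one_le_exp T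
          have : Real.exp (-T) ≤ 1 := Real.exp_le_one_iff.2 (by linarith)
          linarith
        linarith
      rw [hH z hz0, norm_div, norm_pow, norm_pow]
      have he := Real.exp_pos T
      calc ‖z‖ ^ (n + 2) / ‖Complex.sin (Real.pi * z)‖ ^ 2
          ≤ (2 * T) ^ (n + 2) / (Real.exp T / 4) ^ 2 := by gcongr
        _ = 16 * 2 ^ (n + 2) * (T ^ (n + 2) * (Real.exp (-T) * Real.exp (-T))) := by
            rw [Real.exp_neg]; field_simp; ring
        _ ≤ 16 * 2 ^ (n + 2) * (T ^ (n + 2) * (Real.exp (-T) * 1)) := by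
            gcongr
            exact Real.exp_le_one_iff.2 (by linarith)
        _ = _ := by ring
    have := intervalIntegral.norm_integral_le_of_norm_le_const hb
    norm_num at this ⊢
    exact this
  have hL : Tendsto (fun T : ℝ => (∫ y : ℝ in (-T)..T, H (1 / 2 + y * I)) - (∫ y : ℝ in (-T)..T, H (-(1 / 2) + y * I)))
      atTop (𝓝 ((∫ y : ℝ, H (1 / 2 + y * I)) - ∫ y : ℝ, H (-(1 / 2) + y * I))) :=
    (intervalIntegral_tendsto_integral (hint _ (Or.inl rfl)) tendsto_neg_atTop_atBot tendsto_id).sub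
      (intervalIntegral_tendsto_integral (hint _ (Or.inr rfl)) tendsto_neg_atTop_atBot tendsto_id)
  have hR : Tendsto (fun T : ℝ => (∫ y : ℝ in (-T)..T, H (1 / 2 + y * I)) - (∫ y : ℝ in (-T)..T, H (-(1 / 2) + y * I)))
      atTop (𝓝 0) := by
    have h1 := hhor (-1) (by simp)
    have h2 := hhor 1 (by simp)
    simp only [neg_one_mul, one_mul] at h1 h2
    have := (h1.sub h2).const_mul I
    simp only [sub_zero, mul_zero] at this
    exact this.congr fun T => (hrect T).symm
  exact sub_eq_zero.1 (tendsto_nhds_unique hL hR)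

theorem moment_recurrence (n : ℕ) :
    ∑ k ∈ Finset.range n, (n.choose k : ℂ) *
      ∫ t : ℝ, (1 / 2 + t * I : ℂ) ^ k * (bernoulliDensity t : ℂ) = n := by
  set a : ℕ → ℂ := fun k => ∫ t : ℝ, (1 / 2 + t * I : ℂ) ^ k * (bernoulliDensity t : ℂ) with ha
  set b : ℕ → ℂ := fun k => ∫ t : ℝ, (-(1 / 2) + t * I : ℂ) ^ k * (bernoulliDensity t : ℂ) with hb
  have hw : ∫ t : ℝ, (bernoulliDensity t : ℂ) = 1 := by
    rw [integral_complex_ofReal, integral_bernoulliDensity]; simp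
  have ha0 : a 0 = 1 := by simp [ha, hw]
  have hb0 : b 0 = 1 := by simp [hb, hw]
  have hbin : ∀ m, a m = ∑ k ∈ Finset.range (m + 1), (m.choose k : ℂ) * b k := by
    intro m
    simp only [ha, hb]
    simp_rw [← integral_const_mul]
    rw [← integral_finsetSum]
    · congr 1
      ext t
      have : (1 / 2 + t * I : ℂ) = (-(1 / 2) + t * I) + 1 := by ring
      rw [this, add_pow, Finset.sum_mul]
      refine Finset.sum_congr rfl fun k _ => ?_
      simp; ring
    · intro k _
      exact (integrable_pow_mul _ k).const_mul _
  have h1 : a 1 = b 1 + 1 := by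
    rw [hbin 1]; simp [Finset.sum_range_succ, hb0]; ring
  have h2 : ∀ k, k ≠ 1 → a k = b k := by
    intro k hk
    match k with
    | 0 => rw [ha0, hb0]
    | 1 => exact absurd rfl hk
    | m + 2 => exact integral_shift m
  match n with
  | 0 => simp
  | 1 => simpa using hw
  | m + 2 =>
    have e : ∀ k, a k = b k + if k = 1 then 1 else 0 := by
      intro k
      by_cases hk : k = 1
      · subst hk; simp [h1]
      · simp [hk, h2 k hk]
    have h3 := hbin (m + 2)
    rw [Finset.sum_range_succ, h2 (m + 2) (by omega)] at h3
    simp only [Nat.choose_self, Nat.cast_one, one_mul, right_eq_add] at h3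
    change ∑ k ∈ Finset.range (m + 2), ((m + 2).choose k : ℂ) * a k = _
    simp_rw [e, mul_add]
    rw [Finset.sum_add_distrib, h3]
    simp

/-- The defining property `B ^ n = Bₙ` (with `B₁ = 1/2`) of the Bernoulli operator. -/
theorem hasBernoulliValue_pow (n : ℕ) :
    HasBernoulliValue (fun z => z ^ n) ((bernoulli' n : ℚ) : ℂ) := by
  have key : ∀ n : ℕ, ∫ t : ℝ, (1 / 2 + t * I : ℂ) ^ n * (bernoulliDensity t : ℂ) =
      ((bernoulli' n : ℚ) : ℂ) := by
    intro n
    induction n using Nat.strong_induction_on with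
    | _ n ih =>
      have h1 := moment_recurrence (n + 1)
      have h2 : ((∑ k ∈ Finset.range (n + 1), ((n + 1).choose k : ℚ) * bernoulli' k : ℚ) : ℂ) =
          ((n + 1 : ℕ) : ℚ) := by rw [sum_bernoulli']
      push_cast at h2
      rw [Finset.sum_range_succ] at h1 h2
      rw [Finset.sum_congr rfl fun k hk => by rw [ih k (Finset.mem_range.1 hk)]] at h1
      push_cast at h1
      have h3 := h1.trans h2.symm
      have h4 : (((n + 1).choose n : ℕ) : ℂ) ≠ 0 := by
        simp [Nat.choose_succ_self_right]; exact_mod_cast Nat.succ_ne_zero n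
      exact mul_left_cancel₀ h4 (add_left_cancel h3)
  rw [← key n]
  exact hasBernoulliValue_of_integrable (integrable_pow_mul _ n)

end BernoulliOperator

namespace BernoulliOperator

open Complex MeasureTheory Set Filter Topology

/-! Why it holds. On the line `Re z = 1/2` the Bernoulli density is `(π/2) / sin² (π z)`. The
function `z² / sin² (π z)` is holomorphic and decays for `|Re z| ≤ 1/2`, so the value at `B` of `z²
q (z)` can be moved to the imaginary axis (`integral_sq_mul_bernoulliDensity`), where the kernel is
even.

With `D` and `E` for `digammaSeries` and `cotSeries`, `Π'/Π (w) = -γ + w D (w)` and `(π w / 2) cot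
(π w) = 1/2 + w² E (w)`. Termwise, `D + E` is odd. On the imaginary axis its integral against the
even kernel vanishes, so the digamma and cotangent values satisfy `P s + C s = 1/2 - γ s / 2`. The
axis integral for the cotangent converges and is holomorphic for every `Re s ≠ 0`, which provides
both analytic continuations.

Hence the identity in `s` is linear and amounts to the value of `ζ'/ζ` at `B`. The functional
equation, logarithmically differentiated and averaged over `z` and `1 - z`, writes the paired `ζ'/ζ`
through `log 2π`, `1 / sin (π z)` and the paired digamma and cotangent terms
(`logDeriv_riemannZeta_pair`). The poles at zeros of `ζ` on the critical line cancel in the pair.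
Two elementary integrals remain: `C 1 = 1/4` and the value `π²/16` from `∫ sech³`. -/

/-! ### Partial-fraction series away from the nonzero integers -/

/-- The series `∑ 1 / (k (w + k))` over the positive integers `k`. -/
noncomputable def digammaSeries (w : ℂ) : ℂ := ∑' k : ℕ, (((k : ℂ) + 1) * (w + (k + 1)))⁻¹

/-- The series `∑ 1 / (w² - k²)` over the positive integers `k`. -/
noncomputable def cotSeries (w : ℂ) : ℂ := ∑' k : ℕ, (w ^ 2 - ((k : ℂ) + 1) ^ 2)⁻¹

/-- The distance from `w` to every nonzero integer `k` is at least `δ |k|`. -/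
def SeparatedFromInts (δ : ℝ) (w : ℂ) : Prop :=
  ∀ k : ℕ, δ * (k + 1) ≤ ‖w + (k + 1)‖ ∧ δ * (k + 1) ≤ ‖w - (k + 1)‖

/-- The constant `∑ 1 / k²`. -/
noncomputable def sumInvSq : ℝ := ∑' k : ℕ, (((k : ℝ) + 1) ^ 2)⁻¹

theorem summable_inv_succ_sq : Summable fun k : ℕ => (((k : ℝ) + 1) ^ 2)⁻¹ := by
  have := (summable_nat_add_iff 1).2 (Real.summable_nat_pow_inv.2 (one_lt_two))
  simpa using this

theorem SeparatedFromInts.neg {δ : ℝ} {w : ℂ} (h : SeparatedFromInts δ w) :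
    SeparatedFromInts δ (-w) := by
  intro k
  have := h k
  rw [show -w + ((k : ℂ) + 1) = -(w - (k + 1)) by ring,
    show -w - ((k : ℂ) + 1) = -(w + (k + 1)) by ring, norm_neg, norm_neg]
  exact this.symm

theorem norm_succ_cast (k : ℕ) : ‖(k : ℂ) + 1‖ = (k : ℝ) + 1 := by
  have : (k : ℂ) + 1 = ((k + 1 : ℕ) : ℂ) := by push_cast; rfl
  rw [this, Complex.norm_natCast]; push_cast; rfl

theorem SeparatedFromInts.add_ne_zero {δ : ℝ} (hδ : 0 < δ) {w : ℂ} (h : SeparatedFromInts δ w)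
    (k : ℕ) : w + (k + 1) ≠ 0 :=
  norm_pos_iff.1 (lt_of_lt_of_le (by positivity) (h k).1)

theorem SeparatedFromInts.sub_ne_zero {δ : ℝ} (hδ : 0 < δ) {w : ℂ} (h : SeparatedFromInts δ w)
    (k : ℕ) : w - (k + 1) ≠ 0 :=
  norm_pos_iff.1 (lt_of_lt_of_le (by positivity) (h k).2)

theorem SeparatedFromInts.sq_sub_ne_zero {δ : ℝ} (hδ : 0 < δ) {w : ℂ}
    (h : SeparatedFromInts δ w) (k : ℕ) : w ^ 2 - ((k : ℂ) + 1) ^ 2 ≠ 0 := by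
  rw [sq_sub_sq]
  exact mul_ne_zero (h.add_ne_zero hδ k) (h.sub_ne_zero hδ k)

theorem SeparatedFromInts.norm_digamma_term_le {δ : ℝ} (hδ : 0 < δ) {w : ℂ}
    (h : SeparatedFromInts δ w) (k : ℕ) :
    ‖(((k : ℂ) + 1) * (w + (k + 1)))⁻¹‖ ≤ δ⁻¹ * (((k : ℝ) + 1) ^ 2)⁻¹ := by
  rw [norm_inv, norm_mul, norm_succ_cast, ← mul_inv]
  refine inv_anti₀ (by positivity) ?_
  have := (h k).1
  have hk : (0 : ℝ) ≤ (k : ℝ) + 1 := by positivity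
  nlinarith [mul_le_mul_of_nonneg_left this hk]

theorem SeparatedFromInts.norm_cot_term_le {δ : ℝ} (hδ : 0 < δ) {w : ℂ}
    (h : SeparatedFromInts δ w) (k : ℕ) :
    ‖(w ^ 2 - ((k : ℂ) + 1) ^ 2)⁻¹‖ ≤ (δ ^ 2)⁻¹ * (((k : ℝ) + 1) ^ 2)⁻¹ := by
  rw [norm_inv, sq_sub_sq, norm_mul, ← mul_inv]
  refine inv_anti₀ (by positivity) ?_
  have := mul_le_mul (h k).1 (h k).2 (by positivity) (norm_nonneg _)
  linarith

theorem SeparatedFromInts.norm_digammaSeries_le {δ : ℝ} (hδ : 0 < δ) {w : ℂ}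
    (h : SeparatedFromInts δ w) : ‖digammaSeries w‖ ≤ δ⁻¹ * sumInvSq :=
  tsum_of_norm_bounded (summable_inv_succ_sq.hasSum.mul_left _) (h.norm_digamma_term_le hδ)

theorem SeparatedFromInts.norm_cotSeries_le {δ : ℝ} (hδ : 0 < δ) {w : ℂ}
    (h : SeparatedFromInts δ w) : ‖cotSeries w‖ ≤ (δ ^ 2)⁻¹ * sumInvSq :=
  tsum_of_norm_bounded (summable_inv_succ_sq.hasSum.mul_left _) (h.norm_cot_term_le hδ)

theorem cotSeries_neg (w : ℂ) : cotSeries (-w) = cotSeries w := by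
  simp [cotSeries]

/-- Termwise `1 / (k (w + k)) + 1 / ((w - k) (w + k)) = w / (k (w² - k²))`. The right-hand side is
visibly odd in `w`; this is the source of the cancellation between the digamma and cotangent values.
-/
theorem SeparatedFromInts.digammaSeries_add_cotSeries {δ : ℝ} (hδ : 0 < δ) {w : ℂ}
    (h : SeparatedFromInts δ w) :
    digammaSeries w + cotSeries w =
      w * ∑' k : ℕ, (((k : ℂ) + 1) * (w ^ 2 - ((k : ℂ) + 1) ^ 2))⁻¹ := by
  rw [digammaSeries, cotSeries, ← Summable.tsum_add, ← tsum_mul_left]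
  · congr 1; ext k
    have h1 := h.add_ne_zero hδ k
    have h2 := h.sub_ne_zero hδ k
    have h3 : (k : ℂ) + 1 ≠ 0 := Nat.cast_add_one_ne_zero k
    rw [sq_sub_sq]
    field_simp
    ring
  · exact .of_norm_bounded (summable_inv_succ_sq.mul_left _) (h.norm_digamma_term_le hδ)
  · exact .of_norm_bounded (summable_inv_succ_sq.mul_left _) (h.norm_cot_term_le hδ)

theorem SeparatedFromInts.digammaSeries_add_cotSeries_neg {δ : ℝ} (hδ : 0 < δ) {w : ℂ}
    (h : SeparatedFromInts δ w) :
    digammaSeries (-w) + cotSeries (-w) = -(digammaSeries w + cotSeries w) := by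
  rw [h.digammaSeries_add_cotSeries hδ, h.neg.digammaSeries_add_cotSeries hδ]
  simp

/-! ### Oblique strips and holomorphy of the series -/

/-- The open strip `|Re (a w)| < η`. -/
def obliqueStrip (a : ℂ) (η : ℝ) : Set ℂ := {w | |(a * w).re| < η}

theorem isOpen_obliqueStrip (a : ℂ) (η : ℝ) : IsOpen (obliqueStrip a η) :=
  isOpen_lt (by fun_prop) continuous_const

theorem convex_obliqueStrip (a : ℂ) (η : ℝ) : Convex ℝ (obliqueStrip a η) := by
  have : obliqueStrip a η =
      (fun w : ℂ => (a * w).re) ⁻¹' Ioo (-η) η := by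
    ext w; simp [obliqueStrip, abs_lt]
  rw [this]
  refine (convex_Ioo (-η) η).is_linear_preimage ⟨fun x y => ?_, fun c x => ?_⟩
  · simp [mul_add]
  · simp; ring

theorem neg_mem_obliqueStrip {a : ℂ} {η : ℝ} {w : ℂ} (h : w ∈ obliqueStrip a η) :
    -w ∈ obliqueStrip a η := by
  have h : |(a * w).re| < η := h
  change |(a * -w).re| < η
  rwa [mul_neg, neg_re, abs_neg]

theorem obliqueStrip_neg (a : ℂ) (η : ℝ) : obliqueStrip (-a) η = obliqueStrip a η := by
  ext w
  change |(-a * w).re| < η ↔ |(a * w).re| < η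
  rw [neg_mul, neg_re, abs_neg]

/-- For an integer `k ≥ 1`, `‖a‖ ‖w + k‖ ≥ |Re (a w) + k Re a| ≥ k |Re a| - η ≥ k (|Re a| - η)`. The
strip is later used with `a = s⁻¹`, so that it contains the points `z s` with `|Re z| < η`. -/
theorem separatedFromInts_of_mem_obliqueStrip {a : ℂ} {η : ℝ} (ha : a ≠ 0) {w : ℂ}
    (hw : w ∈ obliqueStrip a η) :
    SeparatedFromInts ((|a.re| - η) / ‖a‖) w := by
  have hη : 0 ≤ η := (abs_nonneg _).trans hw.le
  have key : ∀ w ∈ obliqueStrip a η, ∀ k : ℕ, (|a.re| - η) / ‖a‖ * (k + 1) ≤ ‖w + (k + 1)‖ := by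
    intro w hw k
    have hna := norm_pos_iff.2 ha
    rw [div_mul_eq_mul_div, div_le_iff₀ hna]
    have h1 : |(a * (w + (k + 1))).re| ≤ ‖a * (w + (k + 1))‖ := abs_re_le_norm _
    rw [norm_mul] at h1
    have h2 : (a * (w + (k + 1))).re = a.re * (k + 1) + (a * w).re := by
      simp; ring
    have h3 := abs_sub_abs_le_abs_sub (a.re * (k + 1)) (-(a * w).re)
    rw [sub_neg_eq_add, ← h2, abs_neg, abs_mul, abs_of_nonneg (by positivity : (0:ℝ) ≤ (k:ℝ) + 1)] at h3
    have h4 : |(a * w).re| < η := hw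
    have h5 : η ≤ η * ((k : ℝ) + 1) := by nlinarith [(Nat.cast_nonneg k : (0:ℝ) ≤ k)]
    nlinarith
  intro k
  refine ⟨key w hw k, ?_⟩
  have := key (-w) (neg_mem_obliqueStrip hw) k
  rwa [show -w + ((k : ℂ) + 1) = -(w - (k + 1)) by ring, norm_neg] at this

theorem differentiableOn_digammaSeries {a : ℂ} {η : ℝ} (hη : η < |a.re|) :
    DifferentiableOn ℂ digammaSeries (obliqueStrip a η) := by
  rcases eq_or_ne a 0 with rfl | ha
  · intro w hw
    have h : |((0:ℂ) * w).re| < η := hw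
    simp at h hη; linarith
  have hδ : 0 < (|a.re| - η) / ‖a‖ := div_pos (by linarith) (norm_pos_iff.2 ha)
  refine differentiableOn_tsum_of_summable_norm
    (summable_inv_succ_sq.mul_left ((|a.re| - η) / ‖a‖)⁻¹) (fun k => ?_)
    (isOpen_obliqueStrip a η) fun k w hw =>
      (separatedFromInts_of_mem_obliqueStrip ha hw).norm_digamma_term_le hδ k
  refine DifferentiableOn.fun_inv (by fun_prop) fun w hw => mul_ne_zero (Nat.cast_add_one_ne_zero k)
    ((separatedFromInts_of_mem_obliqueStrip ha hw).add_ne_zero hδ k)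

theorem differentiableOn_cotSeries {a : ℂ} {η : ℝ} (hη : η < |a.re|) :
    DifferentiableOn ℂ cotSeries (obliqueStrip a η) := by
  rcases eq_or_ne a 0 with rfl | ha
  · intro w hw
    have h : |((0:ℂ) * w).re| < η := hw
    simp at h hη; linarith
  have hδ : 0 < (|a.re| - η) / ‖a‖ := div_pos (by linarith) (norm_pos_iff.2 ha)
  refine differentiableOn_tsum_of_summable_norm
    (summable_inv_succ_sq.mul_left (((|a.re| - η) / ‖a‖) ^ 2)⁻¹) (fun k => ?_)
    (isOpen_obliqueStrip a η) fun k w hw =>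
      (separatedFromInts_of_mem_obliqueStrip ha hw).norm_cot_term_le hδ k
  refine DifferentiableOn.fun_inv (by fun_prop) fun w hw =>
    ((separatedFromInts_of_mem_obliqueStrip ha hw).sq_sub_ne_zero hδ k)

/-! ### Expansions of the cotangent and of the logarithmic derivative of `Π` -/

theorem pi_mul_cot_eq_cotSeries {w : ℂ} (hw : w ∈ Complex.integerComplement) :
    (Real.pi : ℂ) * w / 2 * (Complex.cos (Real.pi * w) / Complex.sin (Real.pi * w)) =
      1 / 2 + w ^ 2 * cotSeries w := by
  have h0 : w ≠ 0 := integerComplement.ne_zero hw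
  have h := cot_series_rep' hw
  have h1 : ∑' n : ℕ, (1 / (w - ((n : ℂ) + 1)) + 1 / (w + ((n : ℂ) + 1))) =
      2 * w * cotSeries w := by
    rw [cotSeries, ← tsum_mul_left]
    congr 1; ext k
    have e1 : w - ((k : ℂ) + 1) ≠ 0 := by
      simpa [sub_eq_add_neg] using integerComplement_add_ne_zero hw (-(k + 1) : ℤ)
    have e2 : w + ((k : ℂ) + 1) ≠ 0 := by
      simpa using integerComplement_add_ne_zero hw ((k : ℤ) + 1)
    rw [sq_sub_sq]
    field_simp
    ring
  rw [h1, Complex.cot] at h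
  have h2 : (Real.pi : ℂ) * (Complex.cos (Real.pi * w) / Complex.sin (Real.pi * w)) =
      1 / w + 2 * w * cotSeries w := by linear_combination h
  calc _ = w / 2 * ((Real.pi : ℂ) * (Complex.cos (Real.pi * w) / Complex.sin (Real.pi * w))) := by
        ring
    _ = _ := by rw [h2]; field_simp

/-- The `k`-th term of the logarithm of the Weierstrass product of `Γ (z + 1) e ^ (γ z)`. -/
noncomputable def logWeierstrassTerm (k : ℕ) (z : ℂ) : ℂ :=
  z / (k + 1) - Complex.log (1 + z / (k + 1))

/-- Finite form of the Weierstrass product: the convergence factors contribute `exp (z Hₙ)`, the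
power `n ^ z` in `GammaSeq` is removed by `exp (-z log n)`, and the extra `z` cancels the zeroth
factor of its denominator. As `n → ∞`, `Hₙ - log n` gives Euler's constant. -/
theorem exp_sum_logWeierstrassTerm {z : ℂ} (hz : ∀ k : ℕ, z + (k + 1) ≠ 0) (hz0 : z ≠ 0) {n : ℕ}
    (hn : n ≠ 0) :
    Complex.exp (∑ k ∈ Finset.range n, logWeierstrassTerm k z) =
      Complex.GammaSeq z n * z * Complex.exp (z * ((harmonic n - Real.log n : ℝ) : ℂ)) := by
  have hprod : ∏ k ∈ Finset.range n, (1 + z / ((k : ℂ) + 1)) =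
      (∏ k ∈ Finset.range n, (z + ((k : ℂ) + 1))) / (n.factorial : ℂ) := by
    rw [← Finset.prod_range_add_one_eq_factorial, Nat.cast_prod, ← Finset.prod_div_distrib]
    refine Finset.prod_congr rfl fun k _ => ?_
    have : (k : ℂ) + 1 ≠ 0 := Nat.cast_add_one_ne_zero k
    push_cast
    field_simp
    ring
  have hne : ∏ k ∈ Finset.range n, (z + ((k : ℂ) + 1)) ≠ 0 :=
    Finset.prod_ne_zero_iff.2 fun k _ => hz k
  have h1 : ∀ k : ℕ, 1 + z / ((k : ℂ) + 1) ≠ 0 := fun k => by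
    have h2 : (k : ℂ) + 1 ≠ 0 := Nat.cast_add_one_ne_zero k
    have := hz k
    rw [show (1 : ℂ) + z / ((k : ℂ) + 1) = (z + (k + 1)) / (k + 1) by field_simp; ring]
    exact div_ne_zero this h2
  have hH : ((harmonic n : ℝ) : ℂ) = ∑ k ∈ Finset.range n, ((k : ℂ) + 1)⁻¹ := by
    simp [harmonic]
  have hn' : (n : ℂ) ≠ 0 := by exact_mod_cast hn
  have hfac : (n.factorial : ℂ) ≠ 0 := by exact_mod_cast n.factorial_ne_zero
  simp only [logWeierstrassTerm]
  rw [Finset.sum_sub_distrib, Complex.exp_sub, Complex.exp_sum _ (fun k : ℕ => Complex.log _),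
    Finset.prod_congr rfl fun k _ => Complex.exp_log (h1 k), hprod, Complex.GammaSeq,
    Finset.prod_range_succ', Complex.cpow_def_of_ne_zero hn']
  have hsum : ∑ k ∈ Finset.range n, z / ((k : ℂ) + 1) = z * ((harmonic n : ℝ) : ℂ) := by
    rw [hH, Finset.mul_sum]; rfl
  rw [hsum]
  push_cast
  rw [mul_sub, Complex.exp_sub, mul_comm (Complex.log _) z]
  have := Complex.exp_ne_zero (z * Complex.log n)
  simp only [add_zero]
  field_simp

/-- The sum of the logarithms in the Weierstrass product is differentiated term by term, and its
exponential is identified with `Π` through the limit of `GammaSeq`. -/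
theorem digamma_eq_digammaSeries {a : ℂ} {η : ℝ} (hη : η < |a.re|) {w : ℂ}
    (hw : w ∈ obliqueStrip a η) :
    deriv factorialPi w / factorialPi w =
      -(Real.eulerMascheroniConstant : ℂ) + w * digammaSeries w := by
  wlog ha : 0 < a.re generalizing a
  · refine this (a := -a) (by simpa using hη) (by rwa [obliqueStrip_neg]) ?_
    rcases lt_trichotomy a.re 0 with h | h | h
    · simpa using h
    · rw [h, abs_zero] at hη
      exact absurd ((abs_nonneg _).trans_lt hw) (not_lt.2 hη.le)
    · exact absurd h ha
  rw [abs_of_pos ha] at hη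
  have hη0 : 0 < η := (abs_nonneg _).trans_lt hw
  have ha0 : a ≠ 0 := by rintro rfl; simp at ha
  set δ := (|a.re| - η) / ‖a‖ with hδdef
  have hδ : 0 < δ := div_pos (by rw [abs_of_pos ha]; linarith) (norm_pos_iff.2 ha0)
  set r := ‖w‖ + 1
  -- The ball makes the factor `z` in the termwise derivatives bounded by `r`; the intersection is
  -- still convex and contains `0`, where every term vanishes.
  set t := obliqueStrip a η ∩ Metric.ball 0 r
  have hto : IsOpen t := (isOpen_obliqueStrip a η).inter Metric.isOpen_ball
  have htc : IsPreconnected t :=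
    ((convex_obliqueStrip a η).inter (convex_ball 0 r)).isPreconnected
  have hwt : w ∈ t := ⟨hw, by simp [r]⟩
  have h0t : (0 : ℂ) ∈ t := ⟨by simpa [obliqueStrip] using hη0, by simp [r]; positivity⟩
  have hsep : ∀ z ∈ t, SeparatedFromInts δ z := fun z hz =>
    separatedFromInts_of_mem_obliqueStrip ha0 hz.1
  -- Multiplying a nonpositive real by `a`, with `Re a > 0`, gives real part `≤ 0`, whereas here
  -- that real part exceeds `Re a - η > 0`. The principal logarithm is therefore holomorphic at
  -- these points.
  have hslit : ∀ z ∈ t, ∀ k : ℕ, 1 + z / ((k : ℂ) + 1) ∈ slitPlane := by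
    intro z hz k
    by_contra hcon
    rw [Complex.mem_slitPlane_iff, not_or, not_lt, not_not] at hcon
    have h1 : (a * (1 + z / ((k : ℂ) + 1))).re ≤ 0 := by
      rw [Complex.mul_re, hcon.2, mul_zero, sub_zero]
      exact mul_nonpos_of_nonneg_of_nonpos ha.le hcon.1
    have h2 : (a * (1 + z / ((k : ℂ) + 1))).re = a.re + (a * z).re / ((k : ℝ) + 1) := by
      have : a * (1 + z / ((k : ℂ) + 1)) = a + (a * z) / (((k : ℝ) + 1 : ℝ) : ℂ) := by
        push_cast; ring
      rw [this, Complex.add_re, Complex.div_ofReal_re]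
    have h3 : |(a * z).re| < η := hz.1
    have h4 : |(a * z).re / ((k : ℝ) + 1)| ≤ |(a * z).re| := by
      rw [abs_div, abs_of_nonneg (by positivity : (0 : ℝ) ≤ (k : ℝ) + 1)]
      exact div_le_self (abs_nonneg _) (by simp)
    have := neg_abs_le ((a * z).re / ((k : ℝ) + 1))
    linarith
  have hderiv : ∀ (k : ℕ) (z : ℂ), z ∈ t → HasDerivAt (logWeierstrassTerm k)
      (z * (((k : ℂ) + 1) * (z + (k + 1)))⁻¹) z := by
    intro k z hz
    have hk : (k : ℂ) + 1 ≠ 0 := Nat.cast_add_one_ne_zero k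
    have hzk := (hsep z hz).add_ne_zero hδ k
    have h1 : HasDerivAt (fun z : ℂ => z / ((k : ℂ) + 1)) (1 / ((k : ℂ) + 1)) z :=
      (hasDerivAt_id z).div_const _
    refine (h1.sub ((h1.const_add 1).clog (hslit z hz k))).congr_deriv ?_
    have : (1 : ℂ) + z / ((k : ℂ) + 1) ≠ 0 := slitPlane_ne_zero (hslit z hz k)
    have h5 : (1 : ℂ) + z / ((k : ℂ) + 1) = (z + (k + 1)) / (k + 1) := by field_simp; ring
    rw [h5]
    field_simp
    ring
  have hbound : ∀ (k : ℕ) (z : ℂ), z ∈ t → ‖z * (((k : ℂ) + 1) * (z + (k + 1)))⁻¹‖ ≤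
      r * (δ⁻¹ * (((k : ℝ) + 1) ^ 2)⁻¹) := by
    intro k z hz
    rw [norm_mul]
    have h1 : ‖z‖ ≤ r := by simpa using (mem_ball_zero_iff.1 hz.2).le
    exact mul_le_mul h1 ((hsep z hz).norm_digamma_term_le hδ k) (norm_nonneg _) (by positivity)
  have hsum := (summable_inv_succ_sq.mul_left δ⁻¹).mul_left r
  have hs0 : Summable fun k => logWeierstrassTerm k 0 := by simp [logWeierstrassTerm]
  have hL := hasDerivAt_tsum_of_isPreconnected hsum hto htc hderiv hbound h0t hs0 hwt
  have hLs : ∀ z ∈ t, Summable fun k => logWeierstrassTerm k z := fun z hz =>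
    summable_of_summable_hasDerivAt_of_isPreconnected hsum hto htc hderiv hbound h0t hs0 hz
  have hexp : ∀ z ∈ t, factorialPi z =
      Complex.exp (-(Real.eulerMascheroniConstant : ℂ) * z + ∑' k, logWeierstrassTerm k z) := by
    intro z hz
    rcases eq_or_ne z 0 with rfl | hz0
    · simp [factorialPi, logWeierstrassTerm]
    have h1 := (Complex.continuous_exp.tendsto _).comp (hLs z hz).hasSum.tendsto_sum_nat
    have h2 : Tendsto (fun n : ℕ => Complex.GammaSeq z n * z *
        Complex.exp (z * ((harmonic n - Real.log n : ℝ) : ℂ))) atTop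
        (𝓝 (Complex.Gamma z * z * Complex.exp (z * (Real.eulerMascheroniConstant : ℂ)))) := by
      refine ((Complex.GammaSeq_tendsto_Gamma z).mul_const z).mul ?_
      refine (Complex.continuous_exp.tendsto _).comp (Tendsto.const_mul z ?_)
      exact (Complex.continuous_ofReal.tendsto _).comp Real.tendsto_harmonic_sub_log
    have h3 := tendsto_nhds_unique (h1.congr' ?_) h2
    · rw [Complex.exp_add, h3, factorialPi, Complex.Gamma_add_one z hz0, neg_mul, Complex.exp_neg,
        mul_comm z (Real.eulerMascheroniConstant : ℂ)]
      have := Complex.exp_ne_zero ((Real.eulerMascheroniConstant : ℂ) * z)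
      field_simp
    · filter_upwards [eventually_ne_atTop 0] with n hn
      exact exp_sum_logWeierstrassTerm ((hsep z hz).add_ne_zero hδ) hz0 hn
  have hF : HasDerivAt factorialPi (factorialPi w *
      (-(Real.eulerMascheroniConstant : ℂ) + w * digammaSeries w)) w := by
    have h1 := (((hasDerivAt_id w).const_mul (-(Real.eulerMascheroniConstant : ℂ))).add hL).cexp
    refine (h1.congr_of_eventuallyEq ?_).congr_deriv ?_
    · filter_upwards [hto.mem_nhds hwt] with z hz
      simpa using hexp z hz
    · rw [hexp w hwt, digammaSeries, ← tsum_mul_left]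
      simp
  rw [hF.deriv, mul_div_cancel_left₀]
  rw [hexp w hwt]
  exact Complex.exp_ne_zero _

/-! ### The kernel and the shift to the imaginary axis -/

/-- The function `z² / sin² (π z)`, with its removable singularity at `0` removed. -/
noncomputable def bernoulliKernel : ℂ → ℂ := Classical.choose (exists_kernel 0)

theorem bernoulliKernel_of_ne_zero {z : ℂ} (hz : z ≠ 0) :
    bernoulliKernel z = z ^ 2 / Complex.sin (Real.pi * z) ^ 2 := by
  simpa [bernoulliKernel] using (Classical.choose_spec (exists_kernel 0)).1 z hz

theorem differentiableAt_bernoulliKernel {z : ℂ} (hz : |z.re| ≤ 1 / 2) :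
    DifferentiableAt ℂ bernoulliKernel z :=
  (Classical.choose_spec (exists_kernel 0)).2 z hz

theorem bernoulliKernel_neg (z : ℂ) : bernoulliKernel (-z) = bernoulliKernel z := by
  rcases eq_or_ne z 0 with rfl | hz
  · simp
  · rw [bernoulliKernel_of_ne_zero hz, bernoulliKernel_of_ne_zero (neg_ne_zero.2 hz)]
    simp

theorem sq_mul_bernoulliDensity (t : ℝ) :
    (1 / 2 + t * I : ℂ) ^ 2 * (bernoulliDensity t : ℂ) =
      Real.pi / 2 * bernoulliKernel (1 / 2 + t * I) := by
  have hne : (1 / 2 + t * I : ℂ) ≠ 0 := by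
    intro h
    have := congrArg Complex.re h
    norm_num at this
  have hsin : Complex.sin (Real.pi * (1 / 2 + t * I)) = Complex.cosh (Real.pi * t) := by
    have : (Real.pi : ℂ) * (1 / 2 + t * I) = (Real.pi * t) * I + Real.pi / 2 := by ring
    rw [this, Complex.sin_add_pi_div_two, Complex.cos_mul_I]
  rw [bernoulliKernel_of_ne_zero hne, hsin, bernoulliDensity]
  push_cast
  ring

/-- Compactness handles `|Im z| ≤ 1`; beyond it `sin` grows exponentially. Quadratic decay is all
that is needed, since `q` will be bounded. -/
theorem exists_norm_bernoulliKernel_le :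
    ∃ M : ℝ, 0 ≤ M ∧ ∀ z : ℂ, |z.re| ≤ 1 / 2 → ‖bernoulliKernel z‖ ≤ M * (1 + z.im ^ 2)⁻¹ := by
  have hcomp : IsCompact (Icc (-(1 / 2) : ℝ) (1 / 2) ×ℂ Icc (-1 : ℝ) 1) :=
    isCompact_Icc.reProdIm isCompact_Icc
  obtain ⟨M₀, hM₀⟩ := hcomp.exists_bound_of_continuousOn (f := bernoulliKernel) fun z hz =>
    (differentiableAt_bernoulliKernel (abs_le.2 hz.1)).continuousAt.continuousWithinAt
  have hM₀0 : 0 ≤ M₀ := (norm_nonneg _).trans (hM₀ 0 (by constructor <;> norm_num))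
  -- For `|Im z| ≤ 1` the factor `1 + (Im z)²` is at most `2`. For `T = |Im z| ≥ 1` the kernel is at
  -- most `96 / T²`, and `1 + T² ≤ 2 T²` gives `192`.
  refine ⟨2 * M₀ + 192, by positivity, fun z hz => ?_⟩
  have hpos : 0 < 1 + z.im ^ 2 := by positivity
  rw [← div_eq_mul_inv, le_div_iff₀ hpos]
  rcases le_total |z.im| 1 with h | h
  · have h1 := hM₀ z ⟨abs_le.1 hz, abs_le.1 h⟩
    have h2 : z.im ^ 2 ≤ 1 := (sq_le_one_iff_abs_le_one _).2 h
    nlinarith [norm_nonneg (bernoulliKernel z)]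
  · set T := |z.im| with hT
    have hT0 : 0 < T := by linarith
    have hz0 : z ≠ 0 := by
      rintro rfl
      simp [hT] at hT0
    have hnz : ‖z‖ ≤ 2 * T := by
      have := Complex.norm_le_abs_re_add_abs_im z
      linarith
    have hs : Real.exp T / 4 ≤ ‖Complex.sin (Real.pi * z)‖ := by
      refine le_trans ?_ (sinh_le_norm_sin _)
      have him : ((Real.pi : ℂ) * z).im = Real.pi * z.im := by simp
      rw [him, Real.abs_sinh, abs_mul, abs_of_pos Real.pi_pos]
      have h1 : Real.sinh T ≤ Real.sinh (Real.pi * T) :=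
        Real.sinh_le_sinh.2 (by nlinarith [Real.pi_gt_three])
      have h2 : Real.exp T / 4 ≤ Real.sinh T := by
        rw [Real.sinh_eq]
        have := Real.add_one_le_exp T
        have : Real.exp (-T) ≤ 1 := Real.exp_le_one_iff.2 (by linarith)
        linarith
      linarith
    -- The degree-four term of the exponential series: `exp (2 T) ≥ (2 T)⁴ / 4!`, divided by `16`.
    have hexp : T ^ 4 / 24 ≤ (Real.exp T / 4) ^ 2 := by
      have h1 := Real.pow_div_factorial_le_exp (2 * T) (by positivity) 4
      have h2 : Real.exp (2 * T) = Real.exp T ^ 2 := by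
        rw [← Real.exp_nat_mul]; simp
      norm_num [Nat.factorial] at h1
      rw [h2] at h1
      nlinarith
    have hsq : T ^ 4 / 24 ≤ ‖Complex.sin (Real.pi * z)‖ ^ 2 := hexp.trans (by gcongr)
    have h3 : ‖bernoulliKernel z‖ ≤ 96 / T ^ 2 := by
      rw [bernoulliKernel_of_ne_zero hz0, norm_div, norm_pow, norm_pow]
      calc ‖z‖ ^ 2 / ‖Complex.sin (Real.pi * z)‖ ^ 2 ≤ (2 * T) ^ 2 / (T ^ 4 / 24) := by gcongr
        _ = 96 / T ^ 2 := by field_simp; norm_num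
    have h4 : z.im ^ 2 = T ^ 2 := (sq_abs _).symm
    have h5 : 1 ≤ T ^ 2 := one_le_pow₀ h
    have h6 : 96 / T ^ 2 * (1 + T ^ 2) ≤ 192 := by
      rw [div_mul_eq_mul_div, div_le_iff₀ (by positivity)]; linarith
    rw [h4]
    nlinarith [mul_le_mul_of_nonneg_right h3 (by positivity : 0 ≤ 1 + T ^ 2)]

theorem tendsto_inv_one_add_sq : Tendsto (fun T : ℝ => (1 + T ^ 2)⁻¹) atTop (𝓝 0) :=
  tendsto_inv_atTop_zero.comp
    (tendsto_atTop_add_const_left _ _ (tendsto_pow_atTop two_ne_zero))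

/-- Cauchy's theorem on the rectangle of heights `±T`; the horizontal sides are `O (1 / (1 + T²))`.
-/
theorem integral_vertical_line_eq {G : ℂ → ℂ} {a b K : ℝ} (hab : a ≤ b)
    (hG : ∀ z : ℂ, a ≤ z.re → z.re ≤ b → DifferentiableAt ℂ G z)
    (hK : ∀ z : ℂ, a ≤ z.re → z.re ≤ b → ‖G z‖ ≤ K * (1 + z.im ^ 2)⁻¹) :
    ∫ t : ℝ, G (a + t * I) = ∫ t : ℝ, G (b + t * I) := by
  have hint : ∀ c : ℝ, a ≤ c → c ≤ b → Integrable (fun t : ℝ => G (c + t * I)) := by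
    intro c hac hcb
    refine (integrable_inv_one_add_sq.const_mul K).mono' ?_ (Eventually.of_forall fun t => ?_)
    · refine Continuous.aestronglyMeasurable (continuous_iff_continuousAt.2 fun t => ?_)
      exact ContinuousAt.comp (f := fun t : ℝ => (c + t * I : ℂ)) (g := G)
        (hG _ (by simpa using hac) (by simpa using hcb)).continuousAt (by fun_prop)
    · simpa using hK (c + t * I) (by simpa using hac) (by simpa using hcb)
  have hrect : ∀ T : ℝ, (∫ y : ℝ in (-T)..T, G (b + y * I)) - (∫ y : ℝ in (-T)..T, G (a + y * I)) =
      I * ((∫ x : ℝ in a..b, G (x + ((-T : ℝ) : ℂ) * I)) -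
        ∫ x : ℝ in a..b, G (x + (T : ℂ) * I)) := by
    intro T
    have h := Complex.integral_boundary_rect_eq_zero_of_differentiableOn G ⟨a, -T⟩ ⟨b, T⟩ (by
      intro z hz
      have := hz.1
      simp only [mem_preimage] at this
      rw [uIcc_of_le hab] at this
      exact (hG z this.1 this.2).differentiableWithinAt)
    simp only [smul_eq_mul] at h
    push_cast at h ⊢
    have hI : I * I = -1 := I_mul_I
    linear_combination (-I) * h + ((∫ y : ℝ in (-T)..T, G (b + y * I)) -
      (∫ y : ℝ in (-T)..T, G (a + y * I))) * hI
  have hhor : ∀ σ : ℝ, |σ| = 1 →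
      Tendsto (fun T : ℝ => ∫ x : ℝ in a..b, G (x + ((σ * T : ℝ) : ℂ) * I)) atTop (𝓝 0) := by
    intro σ hσ
    have hlim : Tendsto (fun T : ℝ => K * (1 + T ^ 2)⁻¹ * |b - a|) atTop (𝓝 0) := by
      simpa using (tendsto_inv_one_add_sq.const_mul K).mul_const |b - a|
    refine squeeze_zero_norm (fun T => ?_) hlim
    refine intervalIntegral.norm_integral_le_of_norm_le_const fun x hx => ?_
    rw [uIoc_of_le hab] at hx
    have := hK (x + ((σ * T : ℝ) : ℂ) * I) (by simpa using hx.1.le) (by simpa using hx.2)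
    have him : ((x : ℂ) + ((σ * T : ℝ) : ℂ) * I).im ^ 2 = T ^ 2 := by
      rw [show ((x : ℂ) + ((σ * T : ℝ) : ℂ) * I).im = σ * T by simp, mul_pow, ← sq_abs σ, hσ]
      ring
    rwa [him] at this
  have hL : Tendsto (fun T : ℝ => (∫ y : ℝ in (-T)..T, G (b + y * I)) -
      (∫ y : ℝ in (-T)..T, G (a + y * I)))
      atTop (𝓝 ((∫ y : ℝ, G (b + y * I)) - ∫ y : ℝ, G (a + y * I))) :=
    (intervalIntegral_tendsto_integral (hint _ hab le_rfl) tendsto_neg_atTop_atBot tendsto_id).sub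
      (intervalIntegral_tendsto_integral (hint _ le_rfl hab) tendsto_neg_atTop_atBot tendsto_id)
  have hR : Tendsto (fun T : ℝ => (∫ y : ℝ in (-T)..T, G (b + y * I)) -
      (∫ y : ℝ in (-T)..T, G (a + y * I))) atTop (𝓝 0) := by
    have h1 := hhor (-1) (by simp)
    have h2 := hhor 1 (by simp)
    simp only [neg_one_mul, one_mul] at h1 h2
    have := (h1.sub h2).const_mul I
    simp only [sub_zero, mul_zero] at this
    exact this.congr fun T => (hrect T).symm
  exact (sub_eq_zero.1 (tendsto_nhds_unique hL hR)).symm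

/-- For a bounded analytic function `q` on the strip `0 ≤ Re z ≤ 1/2`, the Bernoulli operator value
of `z² q (z)` can be computed on the imaginary axis. -/
theorem integral_sq_mul_bernoulliDensity {q : ℂ → ℂ} {K : ℝ}
    (hq : ∀ z : ℂ, 0 ≤ z.re → z.re ≤ 1 / 2 → DifferentiableAt ℂ q z)
    (hK : ∀ z : ℂ, 0 ≤ z.re → z.re ≤ 1 / 2 → ‖q z‖ ≤ K) :
    Integrable (fun t : ℝ => (1 / 2 + t * I : ℂ) ^ 2 * q (1 / 2 + t * I) *
      (bernoulliDensity t : ℂ)) ∧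
    Integrable (fun t : ℝ => q (t * I) * bernoulliKernel (t * I)) ∧
    ∫ t : ℝ, (1 / 2 + t * I : ℂ) ^ 2 * q (1 / 2 + t * I) * (bernoulliDensity t : ℂ) =
      Real.pi / 2 * ∫ t : ℝ, q (t * I) * bernoulliKernel (t * I) := by
  obtain ⟨M, hM0, hM⟩ := exists_norm_bernoulliKernel_le
  have hK0 : 0 ≤ K := (norm_nonneg _).trans (hK 0 (by simp) (by simp))
  set G : ℂ → ℂ := fun z => q z * bernoulliKernel z with hGdef
  have habs : ∀ z : ℂ, 0 ≤ z.re → z.re ≤ 1 / 2 → |z.re| ≤ 1 / 2 := fun z h0 h1 => by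
    rwa [abs_of_nonneg h0]
  have hGd : ∀ z : ℂ, 0 ≤ z.re → z.re ≤ 1 / 2 → DifferentiableAt ℂ G z := fun z h0 h1 =>
    (hq z h0 h1).mul (differentiableAt_bernoulliKernel (habs z h0 h1))
  have hGb : ∀ z : ℂ, 0 ≤ z.re → z.re ≤ 1 / 2 → ‖G z‖ ≤ K * M * (1 + z.im ^ 2)⁻¹ := by
    intro z h0 h1
    rw [hGdef, norm_mul, mul_assoc]
    exact mul_le_mul (hK z h0 h1) (hM z (habs z h0 h1)) (norm_nonneg _) hK0
  have hint : ∀ c : ℝ, 0 ≤ c → c ≤ 1 / 2 → Integrable (fun t : ℝ => G (c + t * I)) := by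
    intro c hac hcb
    refine (integrable_inv_one_add_sq.const_mul (K * M)).mono' ?_ (Eventually.of_forall fun t => ?_)
    · refine Continuous.aestronglyMeasurable (continuous_iff_continuousAt.2 fun t => ?_)
      exact ContinuousAt.comp (f := fun t : ℝ => (c + t * I : ℂ)) (g := G)
        (hGd _ (by simpa using hac) (by simpa using hcb)).continuousAt (by fun_prop)
    · simpa using hGb (c + t * I) (by simpa using hac) (by simpa using hcb)
  have heq : ∀ t : ℝ, (1 / 2 + t * I : ℂ) ^ 2 * q (1 / 2 + t * I) * (bernoulliDensity t : ℂ) =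
      Real.pi / 2 * G (((1 / 2 : ℝ) : ℂ) + t * I) := by
    intro t
    have := sq_mul_bernoulliDensity t
    simp only [hGdef]
    push_cast
    linear_combination q (1 / 2 + t * I) * this
  have h0 := hint 0 le_rfl (by norm_num)
  simp only [ofReal_zero, zero_add] at h0
  refine ⟨?_, h0, ?_⟩
  · simp_rw [heq]
    exact (hint (1 / 2) (by norm_num) le_rfl).const_mul _
  · simp_rw [heq]
    rw [integral_const_mul]
    congr 1
    have := integral_vertical_line_eq (a := 0) (b := 1 / 2) (by norm_num) hGd hGb
    simp only [ofReal_zero, zero_add] at this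
    exact this.symm

/-! ### Analytic continuation of the cotangent value to `Re s ≠ 0` -/

theorem SeparatedFromInts.mono {δ δ' : ℝ} (h : δ' ≤ δ) {w : ℂ} (hw : SeparatedFromInts δ w) :
    SeparatedFromInts δ' w := fun k =>
  ⟨(mul_le_mul_of_nonneg_right h (by positivity)).trans (hw k).1,
    (mul_le_mul_of_nonneg_right h (by positivity)).trans (hw k).2⟩

/-- The value at `B` of `z ↦ (π z s / 2) cot (π z s)`, as an integral over the imaginary axis which
converges for all `s` off that axis. -/
noncomputable def cotValue (s : ℂ) : ℂ :=
  1 / 2 + Real.pi / 2 * (s ^ 2 * ∫ t : ℝ, cotSeries (t * I * s) * bernoulliKernel (t * I))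

theorem mul_mem_obliqueStrip_inv {s : ℂ} (hs : s ≠ 0) {z : ℂ} {η : ℝ} (hz : |z.re| < η) :
    z * s ∈ obliqueStrip s⁻¹ η := by
  change |(s⁻¹ * (z * s)).re| < η
  rwa [show s⁻¹ * (z * s) = z by field_simp]

theorem abs_re_inv_pos {s : ℂ} (hs : s.re ≠ 0) : 0 < |s⁻¹.re| := by
  have h0 : s ≠ 0 := by rintro rfl; simp at hs
  rw [Complex.inv_re, abs_pos]
  exact div_ne_zero hs (Complex.normSq_pos.2 h0).ne'

/-- The line `i t s` lies in every strip `|Re (s⁻¹ w)| < η` with `η > 0`; the choice `η = |Re s⁻¹| /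
2` produces this constant. -/
theorem separatedFromInts_mul_I_mul {s : ℂ} (hs : s.re ≠ 0) (t : ℝ) :
    SeparatedFromInts (|s.re| / (2 * ‖s‖)) (t * I * s) := by
  have h0 : s ≠ 0 := by rintro rfl; simp at hs
  have hpos := abs_re_inv_pos hs
  have h1 : (t * I * s) ∈ obliqueStrip s⁻¹ (|s⁻¹.re| / 2) :=
    mul_mem_obliqueStrip_inv h0 (by simpa using hpos.ne')
  refine (separatedFromInts_of_mem_obliqueStrip (inv_ne_zero h0) h1).mono (le_of_eq ?_)
  have hn : ‖s‖ ≠ 0 := norm_ne_zero_iff.2 h0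
  rw [Complex.inv_re, Complex.normSq_eq_norm_sq, abs_div, abs_of_nonneg (sq_nonneg ‖s‖), norm_inv]
  field_simp
  ring

/-- A bound uniform in both `t` and nearby `s`, as domination under the integral sign requires: on
this ball `|Re s|` stays at least `|Re s₀| / 2` and `‖s‖` stays bounded. -/
theorem exists_forall_ball_norm_cotSeries_le {s₀ : ℂ} (hs₀ : s₀.re ≠ 0) :
    ∃ K : ℝ, 0 ≤ K ∧ ∀ s ∈ Metric.ball s₀ (|s₀.re| / 2), s.re ≠ 0 ∧
      ∀ t : ℝ, ‖cotSeries (t * I * s)‖ ≤ K := by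
  have hr : 0 < |s₀.re| := abs_pos.2 hs₀
  set δ := |s₀.re| / 2 / (2 * (‖s₀‖ + |s₀.re| / 2))
  have hδ : 0 < δ := by positivity
  have hM : 0 ≤ sumInvSq := tsum_nonneg fun k => by positivity
  refine ⟨(δ ^ 2)⁻¹ * sumInvSq, by positivity, fun s hs => ?_⟩
  rw [mem_ball_iff_norm] at hs
  have h1 : |s₀.re| / 2 ≤ |s.re| := by
    have h2 := abs_re_le_norm (s - s₀)
    have h3 := abs_sub_abs_le_abs_sub s₀.re s.re
    rw [abs_sub_comm] at h3
    rw [Complex.sub_re] at h2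
    linarith
  have h4 : ‖s‖ ≤ ‖s₀‖ + |s₀.re| / 2 := by
    have := norm_sub_norm_le s s₀
    linarith
  have hre : s.re ≠ 0 := by
    rintro h
    rw [h, abs_zero] at h1
    linarith
  have hs0 : 0 < ‖s‖ := norm_pos_iff.2 (by rintro rfl; simp at hre)
  refine ⟨hre, fun t => SeparatedFromInts.norm_cotSeries_le hδ
    ((separatedFromInts_mul_I_mul hre t).mono ?_)⟩
  exact div_le_div₀ (abs_nonneg _) h1 (by positivity) (by linarith)

theorem differentiableAt_cotSeries_of_mul_I {s : ℂ} (hs : s.re ≠ 0) (t : ℝ) :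
    DifferentiableAt ℂ cotSeries (t * I * s) := by
  have h0 : s ≠ 0 := by rintro rfl; simp at hs
  have hpos := abs_re_inv_pos hs
  exact (differentiableOn_cotSeries (half_lt_self hpos)).differentiableAt
    ((isOpen_obliqueStrip _ _).mem_nhds (mul_mem_obliqueStrip_inv h0 (by simpa using hpos.ne')))

theorem differentiableAt_cotValue {s₀ : ℂ} (hs₀ : s₀.re ≠ 0) : DifferentiableAt ℂ cotValue s₀ := by
  have hr : 0 < |s₀.re| := abs_pos.2 hs₀
  obtain ⟨K, hK0, hK⟩ := exists_forall_ball_norm_cotSeries_le hs₀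
  obtain ⟨M, hM0, hM⟩ := exists_norm_bernoulliKernel_le
  set r := |s₀.re| / 4 with hrdef
  have hr0 : 0 < r := by positivity
  have hk : Continuous fun t : ℝ => bernoulliKernel (t * I) :=
    continuous_iff_continuousAt.2 fun t =>
      ContinuousAt.comp (f := fun t : ℝ => (t * I : ℂ)) (g := bernoulliKernel)
        (differentiableAt_bernoulliKernel (by simp)).continuousAt (by fun_prop)
  have hkb : ∀ t : ℝ, ‖bernoulliKernel (t * I)‖ ≤ M * (1 + t ^ 2)⁻¹ := fun t => by
    simpa using hM (t * I) (by simp)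
  have hF : ∀ s : ℂ, s.re ≠ 0 → Continuous fun t : ℝ => cotSeries (t * I * s) := fun s hs =>
    continuous_iff_continuousAt.2 fun t =>
      ContinuousAt.comp (f := fun t : ℝ => (t * I * s : ℂ)) (g := cotSeries)
        (differentiableAt_cotSeries_of_mul_I hs t).continuousAt (by fun_prop)
  have hsub : Metric.ball s₀ r ⊆ Metric.ball s₀ (|s₀.re| / 2) :=
    Metric.ball_subset_ball (by rw [hrdef]; linarith)
  have hd : ∀ s : ℂ, s.re ≠ 0 → ∀ t : ℝ, HasDerivAt (fun s => cotSeries (t * I * s))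
      (deriv cotSeries (t * I * s) * (t * I)) s := fun s hs t => by
    have h1 : HasDerivAt (fun s : ℂ => (t * I : ℂ) * s) (t * I) s := by
      simpa using (hasDerivAt_id s).const_mul (t * I : ℂ)
    exact (differentiableAt_cotSeries_of_mul_I hs t).hasDerivAt.comp s h1
  -- Cauchy's estimate in the variable `s` absorbs the unbounded factor `t` of the chain rule. The
  -- radius fits: `r + r / 2 = 3 |Re s₀| / 8 < |Re s₀| / 2`.
  have hdb : ∀ s ∈ Metric.ball s₀ r, ∀ t : ℝ,
      ‖deriv cotSeries (t * I * s) * (t * I)‖ ≤ K / (r / 2) := by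
    intro s hs t
    have hcl : Metric.closedBall s (r / 2) ⊆ Metric.ball s₀ (|s₀.re| / 2) := by
      refine Metric.closedBall_subset_ball' ?_
      have := Metric.mem_ball.1 hs
      rw [hrdef] at this ⊢
      linarith
    rw [← (hd s (hK s (hsub hs)).1 t).deriv]
    refine Complex.norm_deriv_le_of_forall_mem_sphere_norm_le (by positivity) ?_ fun z hz =>
      (hK z (hcl (Metric.sphere_subset_closedBall hz))).2 t
    refine DifferentiableOn.diffContOnCl fun z hz => ?_
    exact (hd z (hK z (hcl (Metric.closure_ball_subset_closedBall hz))).1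
      t).differentiableAt.differentiableWithinAt
  have key := hasDerivAt_integral_of_dominated_loc_of_deriv_le (μ := volume)
    (F := fun s (t : ℝ) => cotSeries (t * I * s) * bernoulliKernel (t * I))
    (F' := fun s (t : ℝ) => deriv cotSeries (t * I * s) * (t * I) * bernoulliKernel (t * I))
    (x₀ := s₀) (s := Metric.ball s₀ r)
    (bound := fun t => K / (r / 2) * (M * (1 + t ^ 2)⁻¹)) (Metric.ball_mem_nhds _ hr0) ?_ ?_ ?_ ?_
    ((integrable_inv_one_add_sq.const_mul M).const_mul _) ?_
  · unfold cotValue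
    exact ((((differentiableAt_id.pow 2).mul key.2.differentiableAt).const_mul _).const_add _)
  · filter_upwards [Metric.ball_mem_nhds s₀ hr0] with s hs
    exact ((hF s (hK s (hsub hs)).1).mul hk).aestronglyMeasurable
  · refine ((integrable_inv_one_add_sq.const_mul M).const_mul K).mono'
      ((hF s₀ hs₀).mul hk).aestronglyMeasurable (Eventually.of_forall fun t => ?_)
    rw [norm_mul]
    exact mul_le_mul ((hK s₀ (Metric.mem_ball_self (by positivity))).2 t) (hkb t) (norm_nonneg _)
      hK0
  · refine Continuous.aestronglyMeasurable ?_
    refine Continuous.mul (Continuous.mul ?_ (by fun_prop)) hk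
    have h0 : s₀ ≠ 0 := by rintro rfl; simp at hs₀
    have hpos := abs_re_inv_pos hs₀
    have h1 := ((differentiableOn_cotSeries (half_lt_self hpos)).deriv
      (isOpen_obliqueStrip _ _)).continuousOn
    exact h1.comp_continuous (by fun_prop) fun t =>
      mul_mem_obliqueStrip_inv h0 (by simpa using hpos.ne')
  · refine Eventually.of_forall fun t s hs => ?_
    rw [norm_mul]
    exact mul_le_mul (hdb s hs t) (hkb t) (norm_nonneg _) (by positivity)
  · exact Eventually.of_forall fun t s hs => (hd s (hK s (hsub hs)).1 t).mul_const _

/-! ### Bernoulli values of the digamma and cotangent functions -/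

/-- Inversion maps the disc `|s - 1| < 1` to the half-plane `Re > 1/2`. The conclusion says that the
poles `k / s` with `k ≠ 0` lie outside `|Re z| ≤ 1/2`. -/
theorem half_lt_abs_re_inv {s : ℂ} (hs : ‖s - 1‖ < 1 ∨ ‖s + 1‖ < 1) : 1 / 2 < |s⁻¹.re| := by
  have key : ∀ s : ℂ, ‖s - 1‖ < 1 → 1 / 2 < s⁻¹.re := by
    intro s hs
    have h0 : s ≠ 0 := by rintro rfl; simp at hs
    have h1 : ‖s - 1‖ ^ 2 < 1 := by
      have := norm_nonneg (s - 1)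
      nlinarith
    rw [← Complex.normSq_eq_norm_sq, Complex.normSq_apply] at h1
    simp only [sub_re, one_re, sub_im, one_im, sub_zero] at h1
    rw [Complex.inv_re, lt_div_iff₀ (Complex.normSq_pos.2 h0), Complex.normSq_apply]
    linarith
  rcases hs with hs | hs
  · exact (key s hs).trans_le (le_abs_self _)
  · have h := key (-s) (by rwa [← norm_neg, neg_sub, sub_neg_eq_add, add_comm])
    rw [inv_neg, neg_re] at h
    exact h.trans_le (neg_le_abs _)

theorem integrable_bernoulliDensity : Integrable fun t : ℝ => (bernoulliDensity t : ℂ) := by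
  simpa using integrable_pow_mul 0 0

theorem integral_ofReal_bernoulliDensity : ∫ t : ℝ, (bernoulliDensity t : ℂ) = 1 := by
  rw [integral_complex_ofReal, integral_bernoulliDensity]; simp

theorem integral_half_add_mul_I_mul_bernoulliDensity :
    ∫ t : ℝ, (1 / 2 + t * I : ℂ) * (bernoulliDensity t : ℂ) = 1 / 2 := by
  have h1 := hasBernoulliValue_of_integrable (f := fun z => z ^ 1) (integrable_pow_mul (1 / 2) 1)
  have h2 := h1.2.symm.trans (hasBernoulliValue_pow 1).2
  simpa using h2

theorem half_add_mul_I_mul_mem_integerComplement {s : ℂ} (hs : 1 / 2 < |s⁻¹.re|) (t : ℝ) :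
    (1 / 2 + t * I) * s ∈ Complex.integerComplement := by
  have h0 : s ≠ 0 := by rintro rfl; norm_num at hs
  rintro ⟨k, hk⟩
  have h1 : (1 / 2 + t * I : ℂ) = k * s⁻¹ := by
    rw [hk]; field_simp
  have h2 := congrArg Complex.re h1
  have h3 : ((k : ℂ) * s⁻¹).re = k * s⁻¹.re := by
    rw [Complex.mul_re]; simp
  rw [h3] at h2
  norm_num at h2
  rcases eq_or_ne k 0 with rfl | hk0
  · norm_num at h2
  · have h4 : (1 : ℝ) ≤ |(k : ℝ)| := by exact_mod_cast Int.one_le_abs hk0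
    have h5 := congrArg abs h2
    rw [abs_mul, Complex.inv_re] at *
    norm_num [abs_div, abs_inv] at *
    nlinarith

/-- The midpoint of `1/2` and `|Re s⁻¹|` leaves room on both sides: the closed strip `|Re z| ≤ 1/2`
is covered and a positive distance from the nonzero integers remains. -/
theorem exists_obliqueStrip {s : ℂ} (hs : 1 / 2 < |s⁻¹.re|) : s ≠ 0 ∧ ∃ η : ℝ, η < |s⁻¹.re| ∧
    ∀ z : ℂ, |z.re| ≤ 1 / 2 → z * s ∈ obliqueStrip s⁻¹ η := by
  have h0 : s ≠ 0 := by rintro rfl; norm_num at hs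
  exact ⟨h0, (1 / 2 + |s⁻¹.re|) / 2, by linarith, fun z hz =>
    mul_mem_obliqueStrip_inv h0 (by linarith)⟩

theorem hasBernoulliValue_pi_mul_cot {s : ℂ} (hs : 1 / 2 < |s⁻¹.re|) :
    HasBernoulliValue (fun z => (Real.pi : ℂ) * (z * s) / 2 *
      (Complex.cos (Real.pi * (z * s)) / Complex.sin (Real.pi * (z * s)))) (cotValue s) := by
  obtain ⟨h0, η, hη, hmem⟩ := exists_obliqueStrip hs
  have hδ : 0 < (|s⁻¹.re| - η) / ‖s⁻¹‖ := div_pos (by linarith) (norm_pos_iff.2 (inv_ne_zero h0))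
  obtain ⟨hi, -, he⟩ := integral_sq_mul_bernoulliDensity (q := fun z => cotSeries (z * s))
    (fun z h1 h2 => DifferentiableAt.comp z (g := cotSeries)
      ((differentiableOn_cotSeries hη).differentiableAt
        ((isOpen_obliqueStrip _ _).mem_nhds (hmem z (by rwa [abs_of_nonneg h1])))) (by fun_prop))
    (fun z h1 h2 => (separatedFromInts_of_mem_obliqueStrip (inv_ne_zero h0)
      (hmem z (by rwa [abs_of_nonneg h1]))).norm_cotSeries_le hδ)
  have heq : (fun t : ℝ => (Real.pi : ℂ) * ((1 / 2 + t * I) * s) / 2 *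
      (Complex.cos (Real.pi * ((1 / 2 + t * I) * s)) /
        Complex.sin (Real.pi * ((1 / 2 + t * I) * s))) * (bernoulliDensity t : ℂ)) =
      fun t : ℝ => 1 / 2 * (bernoulliDensity t : ℂ) + s ^ 2 * ((1 / 2 + t * I : ℂ) ^ 2 *
        cotSeries ((1 / 2 + t * I) * s) * (bernoulliDensity t : ℂ)) := by
    ext t
    rw [pi_mul_cot_eq_cotSeries (half_add_mul_I_mul_mem_integerComplement hs t)]
    ring
  have h1 := integrable_bernoulliDensity.const_mul (1 / 2 : ℂ)
  have h2 := hi.const_mul (s ^ 2)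
  have hint := h1.add h2
  have hval := hasBernoulliValue_of_integrable (f := fun z => (Real.pi : ℂ) * (z * s) / 2 *
      (Complex.cos (Real.pi * (z * s)) / Complex.sin (Real.pi * (z * s)))) (by rw [heq]; exact hint)
  convert hval using 1
  rw [heq, integral_add h1 h2, integral_const_mul, integral_const_mul,
    integral_ofReal_bernoulliDensity, he, cotValue]
  ring

/-- The value at `B` of `z ↦ z s Π' (z s) / Π (z s)`. -/
noncomputable def digammaValue (s : ℂ) : ℂ :=
  1 / 2 - Real.eulerMascheroniConstant / 2 * s - cotValue s

theorem hasBernoulliValue_mul_digamma {s : ℂ} (hs : 1 / 2 < |s⁻¹.re|) :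
    HasBernoulliValue (fun z => z * s * (deriv factorialPi (z * s) / factorialPi (z * s)))
      (digammaValue s) := by
  obtain ⟨h0, η, hη, hmem⟩ := exists_obliqueStrip hs
  have hδ : 0 < (|s⁻¹.re| - η) / ‖s⁻¹‖ := div_pos (by linarith) (norm_pos_iff.2 (inv_ne_zero h0))
  have hsep : ∀ z : ℂ, |z.re| ≤ 1 / 2 → SeparatedFromInts _ (z * s) := fun z hz =>
    separatedFromInts_of_mem_obliqueStrip (inv_ne_zero h0) (hmem z hz)
  obtain ⟨-, hic, -⟩ := integral_sq_mul_bernoulliDensity (q := fun z => cotSeries (z * s))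
    (fun z h1 h2 => DifferentiableAt.comp z (g := cotSeries)
      ((differentiableOn_cotSeries hη).differentiableAt
        ((isOpen_obliqueStrip _ _).mem_nhds (hmem z (by rwa [abs_of_nonneg h1])))) (by fun_prop))
    (fun z h1 h2 => (hsep z (by rwa [abs_of_nonneg h1])).norm_cotSeries_le hδ)
  obtain ⟨hi, hid, he⟩ := integral_sq_mul_bernoulliDensity (q := fun z => digammaSeries (z * s))
    (fun z h1 h2 => DifferentiableAt.comp z (g := digammaSeries)
      ((differentiableOn_digammaSeries hη).differentiableAt
        ((isOpen_obliqueStrip _ _).mem_nhds (hmem z (by rwa [abs_of_nonneg h1])))) (by fun_prop))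
    (fun z h1 h2 => (hsep z (by rwa [abs_of_nonneg h1])).norm_digammaSeries_le hδ)
  -- The key cancellation: the sum of the two integrands is odd in `t`, because the kernel is even
  -- and the sum of the two series is odd.
  have hodd : (∫ t : ℝ, digammaSeries (t * I * s) * bernoulliKernel (t * I)) =
      -∫ t : ℝ, cotSeries (t * I * s) * bernoulliKernel (t * I) := by
    rw [eq_neg_iff_add_eq_zero, ← integral_add hid hic]
    set F : ℝ → ℂ := fun t => digammaSeries (t * I * s) * bernoulliKernel (t * I) +
      cotSeries (t * I * s) * bernoulliKernel (t * I) with hF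
    have hFodd : ∀ t, F (-t) = -F t := by
      intro t
      simp only [hF]
      have h := (hsep (t * I) (by simp)).digammaSeries_add_cotSeries_neg hδ
      rw [ofReal_neg, neg_mul, neg_mul, bernoulliKernel_neg]
      linear_combination bernoulliKernel (t * I) * h
    have h1 := integral_neg_eq_self F volume
    simp_rw [hFodd, integral_neg] at h1
    linear_combination (-1 / 2 : ℂ) * h1
  have heq : (fun t : ℝ => (1 / 2 + t * I) * s * (deriv factorialPi ((1 / 2 + t * I) * s) /
      factorialPi ((1 / 2 + t * I) * s)) * (bernoulliDensity t : ℂ)) =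
      fun t : ℝ => -(Real.eulerMascheroniConstant : ℂ) * s *
        ((1 / 2 + t * I : ℂ) * (bernoulliDensity t : ℂ)) + s ^ 2 * ((1 / 2 + t * I : ℂ) ^ 2 *
        digammaSeries ((1 / 2 + t * I) * s) * (bernoulliDensity t : ℂ)) := by
    ext t
    rw [digamma_eq_digammaSeries hη (hmem _ (by norm_num))]
    ring
  have h1 := (integrable_pow_mul (1 / 2) 1).const_mul (-(Real.eulerMascheroniConstant : ℂ) * s)
  simp only [pow_one] at h1
  have h2 := hi.const_mul (s ^ 2)
  have hint := h1.add h2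
  have hval := hasBernoulliValue_of_integrable
    (f := fun z => z * s * (deriv factorialPi (z * s) / factorialPi (z * s)))
    (by rw [heq]; exact hint)
  convert hval using 1
  rw [heq, integral_add h1 h2, integral_const_mul, integral_const_mul,
    integral_half_add_mul_I_mul_bernoulliDensity, he, hodd, digammaValue, cotValue]
  ring

theorem hasBernoulliFamily_pi_mul_cot :
    HasBernoulliFamily (fun w => (Real.pi : ℂ) * w / 2 *
      (Complex.cos ((Real.pi : ℂ) * w) / Complex.sin ((Real.pi : ℂ) * w))) cotValue where
  differentiableOn _ hs := (differentiableAt_cotValue hs).differentiableWithinAt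
  hasBernoulliValue _ hs := hasBernoulliValue_pi_mul_cot (half_lt_abs_re_inv hs)

theorem hasBernoulliFamily_mul_digamma :
    HasBernoulliFamily (fun w => w * (deriv factorialPi w / factorialPi w)) digammaValue where
  differentiableOn _ hs := by
    have := differentiableAt_cotValue hs
    unfold digammaValue
    exact DifferentiableAt.differentiableWithinAt (by fun_prop)
  hasBernoulliValue _ hs := hasBernoulliValue_mul_digamma (half_lt_abs_re_inv hs)

/-! ### Two elementary integrals and the cotangent value at `s = 1` -/

theorem tendsto_tanh_atTop : Tendsto Real.tanh atTop (𝓝 1) := by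
  have h1 : Tendsto (fun x : ℝ => Real.exp (-(2 * x))) atTop (𝓝 0) :=
    Real.tendsto_exp_neg_atTop_nhds_zero.comp (tendsto_id.const_mul_atTop (by norm_num))
  have h2 : Tendsto (fun x : ℝ => (1 - Real.exp (-(2 * x))) / (1 + Real.exp (-(2 * x)))) atTop
      (𝓝 ((1 - 0) / (1 + 0))) := (h1.const_sub 1).div (h1.const_add 1) (by norm_num)
  simp only [sub_zero, add_zero, div_one] at h2
  refine h2.congr fun x => ?_
  rw [Real.tanh_eq_sinh_div_cosh, Real.sinh_eq, Real.cosh_eq]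
  have e : Real.exp (-(2*x)) = Real.exp (-x) * Real.exp (-x) := by rw [← Real.exp_add]; ring_nf
  have e2 : Real.exp x * Real.exp (-x) = 1 := by rw [← Real.exp_add]; simp
  have := Real.exp_pos x
  have := Real.exp_pos (-x)
  rw [div_eq_div_iff (by positivity) (by positivity), e]
  linear_combination (-Real.exp (-x)) * e2

theorem tendsto_pi_mul_atTop : Tendsto (fun t : ℝ => Real.pi * t) atTop atTop :=
  tendsto_id.const_mul_atTop Real.pi_pos

theorem integral_mul_tanh_mul_bernoulliDensity :
    ∫ t in Ioi (0 : ℝ), Real.pi * t * Real.tanh (Real.pi * t) * bernoulliDensity t = 1 / 4 := by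
  -- Integration by parts: the density `ρ` satisfies `ρ' = -2 π tanh (π t) ρ`, and `ρ` is the
  -- derivative of `tanh (π t) / 2`.
  set A : ℝ → ℝ := fun t => Real.tanh (Real.pi * t) / 4 - t * bernoulliDensity t / 2 with hA
  have hd : ∀ t ∈ Ici (0 : ℝ), HasDerivAt A
      (Real.pi * t * Real.tanh (Real.pi * t) * bernoulliDensity t) t := by
    intro t _
    have h0 := (Real.cosh_pos (Real.pi * t)).ne'
    have h1 : HasDerivAt (fun t : ℝ => Real.pi * t) Real.pi t := by
      simpa using (hasDerivAt_id t).const_mul Real.pi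
    have h2 := (h1.sinh.div h1.cosh h0).div_const 4
    have h3 := ((hasDerivAt_id t).mul ((hasDerivAt_const t Real.pi).div
      ((h1.cosh.pow 2).const_mul 2) (mul_ne_zero two_ne_zero (pow_ne_zero 2 h0)))).div_const 2
    have h4 := h2.sub h3
    have hAe : A = fun t => Real.sinh (Real.pi * t) / Real.cosh (Real.pi * t) / 4 -
        t * (Real.pi / (2 * Real.cosh (Real.pi * t) ^ 2)) / 2 := by
      ext t; simp only [hA, Real.tanh_eq_sinh_div_cosh, bernoulliDensity]
    rw [hAe]
    refine h4.congr_deriv ?_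
    rw [Real.tanh_eq_sinh_div_cosh, bernoulliDensity]
    have := Real.cosh_sq (Real.pi * t)
    simp
    field_simp
    rw [Real.sinh_sq]
    ring
  have hlim : Tendsto A atTop (𝓝 (1 / 4)) := by
    have h1 := (tendsto_tanh_atTop.comp tendsto_pi_mul_atTop).div_const 4
    have h2 : Tendsto (fun t : ℝ => t * bernoulliDensity t / 2) atTop (𝓝 0) := by
      have h3 : Tendsto (fun t : ℝ => Real.pi * (t ^ 1 * Real.exp (-t))) atTop (𝓝 0) := by
        simpa using (Real.tendsto_pow_mul_exp_neg_atTop_nhds_zero 1).const_mul Real.pi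
      refine squeeze_zero' ?_ ?_ h3
      · filter_upwards [eventually_ge_atTop 0] with t ht
        have := bernoulliDensity_nonneg t
        positivity
      · filter_upwards [eventually_ge_atTop 0] with t ht
        have h4 := bernoulliDensity_le t
        have h5 : Real.exp (-(2 * t)) ≤ Real.exp (-t) := Real.exp_le_exp.2 (by linarith)
        have h6 : bernoulliDensity t ≤ 2 * Real.pi * Real.exp (-t) := h4.trans (by gcongr)
        nlinarith [mul_le_mul_of_nonneg_left h6 ht]
    simpa using h1.sub h2
  have hpos : ∀ t ∈ Ioi (0 : ℝ),
      0 ≤ Real.pi * t * Real.tanh (Real.pi * t) * bernoulliDensity t := by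
    intro t ht
    have ht : 0 < t := ht
    have h1 : 0 ≤ Real.tanh (Real.pi * t) := by
      rw [Real.tanh_eq_sinh_div_cosh]
      exact div_nonneg (Real.sinh_nonneg_iff.2 (by positivity)) (Real.cosh_pos _).le
    have := bernoulliDensity_nonneg t
    positivity
  rw [integral_Ioi_of_hasDerivAt_of_tendsto' hd (integrableOn_Ioi_deriv_of_nonneg' hd hpos hlim)
    hlim]
  simp [hA]

theorem tendsto_sinh_atTop : Tendsto Real.sinh atTop atTop :=
  tendsto_atTop_mono' _ (by
    filter_upwards [eventually_ge_atTop 0] with t ht using Real.self_le_sinh_iff.2 ht) tendsto_id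

theorem integral_inv_cosh_mul_bernoulliDensity :
    IntegrableOn (fun t : ℝ => Real.pi / 2 / Real.cosh (Real.pi * t) * bernoulliDensity t)
      (Ioi 0) ∧
    ∫ t in Ioi (0 : ℝ), Real.pi / 2 / Real.cosh (Real.pi * t) * bernoulliDensity t =
      Real.pi ^ 2 / 16 := by
  -- The integrand is `(π² / 4) sech³ (π t)`, and `sech³` has the primitive `(sinh / cosh² + arctan
  -- sinh) / 2`.
  set A : ℝ → ℝ := fun t => Real.pi / 8 * (Real.sinh (Real.pi * t) / Real.cosh (Real.pi * t) ^ 2 +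
    Real.arctan (Real.sinh (Real.pi * t))) with hA
  have hd : ∀ t ∈ Ici (0 : ℝ), HasDerivAt A
      (Real.pi / 2 / Real.cosh (Real.pi * t) * bernoulliDensity t) t := by
    intro t _
    have h0 := (Real.cosh_pos (Real.pi * t)).ne'
    have h1 : HasDerivAt (fun t : ℝ => Real.pi * t) Real.pi t := by
      simpa using (hasDerivAt_id t).const_mul Real.pi
    have h2 := ((h1.sinh.div (h1.cosh.pow 2) (pow_ne_zero 2 h0)).add h1.sinh.arctan).const_mul
      (Real.pi / 8)
    refine h2.congr_deriv ?_
    rw [bernoulliDensity, add_comm (1 : ℝ), ← Real.cosh_sq]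
    simp
    field_simp
    rw [Real.sinh_sq]
    ring
  have hlim : Tendsto A atTop (𝓝 (Real.pi ^ 2 / 16)) := by
    have h1 : Tendsto (fun t : ℝ => Real.arctan (Real.sinh (Real.pi * t))) atTop
        (𝓝 (Real.pi / 2)) :=
      (tendsto_nhds_of_tendsto_nhdsWithin Real.tendsto_arctan_atTop).comp
        (tendsto_sinh_atTop.comp tendsto_pi_mul_atTop)
    have h2 : Tendsto (fun t : ℝ => Real.sinh (Real.pi * t) / Real.cosh (Real.pi * t) ^ 2) atTop
        (𝓝 0) := by
      have h3 : Tendsto (fun t : ℝ => (Real.sinh (Real.pi * t))⁻¹) atTop (𝓝 0) :=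
        tendsto_inv_atTop_zero.comp (tendsto_sinh_atTop.comp tendsto_pi_mul_atTop)
      refine squeeze_zero' ?_ ?_ h3
      · filter_upwards [eventually_ge_atTop 0] with t ht
        have := Real.sinh_nonneg_iff.2 (by positivity : 0 ≤ Real.pi * t)
        positivity
      · filter_upwards [eventually_gt_atTop 0] with t ht
        have := Real.sinh_pos_iff.2 (by positivity : 0 < Real.pi * t)
        have h4 := Real.cosh_sq (Real.pi * t)
        have h5 : 0 < Real.cosh (Real.pi * t) ^ 2 := by have := Real.cosh_pos (Real.pi * t); positivity
        rw [inv_eq_one_div, div_le_div_iff₀ h5 this]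
        nlinarith
    have := (h2.add h1).const_mul (Real.pi / 8)
    convert this using 2
    ring
  have hpos : ∀ t ∈ Ioi (0 : ℝ),
      0 ≤ Real.pi / 2 / Real.cosh (Real.pi * t) * bernoulliDensity t := by
    intro t _
    have := bernoulliDensity_nonneg t
    have := Real.cosh_pos (Real.pi * t)
    positivity
  have hi := integrableOn_Ioi_deriv_of_nonneg' hd hpos hlim
  refine ⟨hi, ?_⟩
  rw [integral_Ioi_of_hasDerivAt_of_tendsto' hd hi hlim]
  simp [hA]

theorem sin_pi_mul_half_add (t : ℝ) :
    Complex.sin (Real.pi * (1 / 2 + t * I)) = Complex.cosh (Real.pi * t) := by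
  rw [show (Real.pi : ℂ) * (1 / 2 + t * I) = (Real.pi * t) * I + Real.pi / 2 by ring,
    Complex.sin_add_pi_div_two, Complex.cos_mul_I]

theorem cos_pi_mul_half_add (t : ℝ) :
    Complex.cos (Real.pi * (1 / 2 + t * I)) = -(Complex.sinh (Real.pi * t) * I) := by
  rw [show (Real.pi : ℂ) * (1 / 2 + t * I) = (Real.pi * t) * I + Real.pi / 2 by ring,
    Complex.cos_add_pi_div_two, Complex.sin_mul_I]

/-- Computed on the line `Re z = 1/2` rather than on the imaginary axis: there `cot (π z) = -i tanh
(π t)`, and pairing `t` with `-t` leaves `π t tanh (π t)`. -/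
theorem cotValue_one : cotValue 1 = 1 / 4 := by
  have h := (hasBernoulliFamily_pi_mul_cot.hasBernoulliValue 1 (by simp)).2
  rw [← h]
  have heq : ∀ t : ℝ, ((Real.pi : ℂ) * ((1 / 2 + t * I) * 1) / 2 *
      (Complex.cos (Real.pi * ((1 / 2 + t * I) * 1)) /
        Complex.sin (Real.pi * ((1 / 2 + t * I) * 1))) +
      (Real.pi : ℂ) * ((1 / 2 - t * I) * 1) / 2 *
      (Complex.cos (Real.pi * ((1 / 2 - t * I) * 1)) /
        Complex.sin (Real.pi * ((1 / 2 - t * I) * 1)))) * (bernoulliDensity t : ℂ) =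
      ((Real.pi * t * Real.tanh (Real.pi * t) * bernoulliDensity t : ℝ) : ℂ) := by
    intro t
    have e : (1 / 2 - t * I : ℂ) = 1 / 2 + ((-t : ℝ) : ℂ) * I := by push_cast; ring
    have hc : Complex.cosh (Real.pi * t) ≠ 0 := by
      have := (Real.cosh_pos (Real.pi * t)).ne'
      exact_mod_cast this
    rw [e]
    simp only [mul_one, sin_pi_mul_half_add, cos_pi_mul_half_add]
    push_cast
    rw [mul_neg, Complex.sinh_neg, Complex.cosh_neg, Complex.tanh_eq_sinh_div_cosh]
    field_simp
    ring_nf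
    rw [I_sq]
    ring
  simp_rw [heq]
  rw [integral_complex_ofReal, integral_mul_tanh_mul_bernoulliDensity]
  norm_num

/-! ### The logarithmic derivative of zeta and the functional equation -/

/-- The zeros of a nonzero analytic function on the connected set `ℂ ∖ {1}` form a discrete set,
hence a countable one. -/
theorem ae_riemannZeta_ne_zero : ∀ᵐ t : ℝ, riemannZeta (1 / 2 + t * I) ≠ 0 := by
  have hconn : IsConnected ({1}ᶜ : Set ℂ) :=
    isConnected_compl_singleton_of_one_lt_rank (by rw [Complex.rank_real_complex]; norm_num) 1
  have h2 : riemannZeta 2 ≠ 0 := riemannZeta_ne_zero_of_one_lt_re (by norm_num)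
  have hcod := analyticOn_riemannZeta.preimage_zero_mem_codiscreteWithin h2 (by norm_num) hconn
  set Z : Set ℂ := (riemannZeta ⁻¹' {0}ᶜ)ᶜ ∩ {1}ᶜ with hZ
  have : DiscreteTopology ↑Z := isDiscrete_iff_discreteTopology.mp
    <| isDiscrete_of_codiscreteWithin ((compl_compl (riemannZeta ⁻¹' {0}ᶜ)).symm ▸ hcod)
  have hcount : Z.Countable := TopologicalSpace.separableSpace_iff_countable.1 inferInstance
  have hinj : Function.Injective fun t : ℝ => (1 / 2 + t * I : ℂ) := by
    intro t u h
    have := congrArg Complex.im h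
    simpa using this
  have hpre := (hcount.preimage hinj).ae_notMem volume
  filter_upwards [hpre] with t ht h0
  refine ht ⟨by simpa using h0, ?_⟩
  intro h1
  have := congrArg Complex.re (mem_singleton_iff.1 h1)
  norm_num at this

/-- The logarithmic derivative of the functional equation of `ζ`. -/
theorem logDeriv_riemannZeta_one_sub {z : ℂ} (hz : ∀ n : ℤ, z ≠ n) (hζ : riemannZeta z ≠ 0) :
    deriv riemannZeta z / riemannZeta z + deriv riemannZeta (1 - z) / riemannZeta (1 - z) =
      Real.log (2 * Real.pi) + Real.pi / 2 *
        (Complex.sin (Real.pi * z / 2) / Complex.cos (Real.pi * z / 2)) -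
        deriv Complex.Gamma z / Complex.Gamma z := by
  have hz0 : z ≠ 0 := by simpa using hz 0
  have hz1 : z ≠ 1 := by simpa using hz 1
  have hzn : ∀ n : ℕ, z ≠ -n := fun n => by simpa using hz (-n)
  have hpi : (Real.pi : ℂ) ≠ 0 := by exact_mod_cast Real.pi_ne_zero
  have h2pi : (2 * Real.pi : ℂ) ≠ 0 := mul_ne_zero two_ne_zero hpi
  have hcos : Complex.cos (Real.pi * z / 2) ≠ 0 := by
    rw [Ne, Complex.cos_eq_zero_iff]
    rintro ⟨k, hk⟩
    refine hz (2 * k + 1) (mul_left_cancel₀ hpi ?_)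
    push_cast
    linear_combination 2 * hk
  have hG := Complex.Gamma_ne_zero hzn
  have hpow : (2 * Real.pi : ℂ) ^ (-z) ≠ 0 := by
    rw [Complex.cpow_def_of_ne_zero h2pi]; exact Complex.exp_ne_zero _
  have hlog : Complex.log (2 * Real.pi) = Real.log (2 * Real.pi) := by
    rw [Complex.ofReal_log (by positivity)]; push_cast; rfl
  have d1 : HasDerivAt (fun s : ℂ => 2 * (2 * Real.pi : ℂ) ^ (-s))
      (2 * ((2 * Real.pi : ℂ) ^ (-z) * Complex.log (2 * Real.pi) * (-1))) z :=
    ((hasDerivAt_neg z).const_cpow (Or.inl h2pi)).const_mul 2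
  have d2 := (Complex.differentiableAt_Gamma z hzn).hasDerivAt
  have d3 : HasDerivAt (fun s : ℂ => Complex.cos (Real.pi * s / 2))
      (-Complex.sin (Real.pi * z / 2) * (Real.pi / 2)) z := by
    have : HasDerivAt (fun s : ℂ => (Real.pi : ℂ) * s / 2) (Real.pi / 2) z := by
      simpa using ((hasDerivAt_id z).const_mul (Real.pi : ℂ)).div_const 2
    exact this.ccos
  have d4 := (differentiableAt_riemannZeta hz1).hasDerivAt
  have dR := ((d1.mul d2).mul d3).mul d4
  have hz1' : 1 - z ≠ 1 := by simpa using hz0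
  have dL : HasDerivAt (fun s : ℂ => riemannZeta (1 - s)) (-deriv riemannZeta (1 - z)) z := by
    have h1 : HasDerivAt (fun s : ℂ => 1 - s) (-1) z := (hasDerivAt_id z).const_sub 1
    have h := (differentiableAt_riemannZeta hz1').hasDerivAt.comp z h1
    rwa [mul_neg_one] at h
  have heq : (fun s : ℂ => riemannZeta (1 - s)) =ᶠ[𝓝 z]
      fun s => 2 * (2 * Real.pi : ℂ) ^ (-s) * Complex.Gamma s * Complex.cos (Real.pi * s / 2) *
        riemannZeta s := by
    have h1 : ∀ᶠ s in 𝓝 z, Complex.Gamma s ≠ 0 :=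
      (Complex.differentiableAt_Gamma z hzn).continuousAt.eventually_ne hG
    filter_upwards [h1, isOpen_ne.mem_nhds hz1] with s hs hs1
    refine riemannZeta_one_sub (fun n hn => hs ?_) hs1
    rw [hn, Complex.Gamma_neg_nat_eq_zero]
  have hd := dL.unique (dR.congr_of_eventuallyEq heq)
  have hv := heq.eq_of_nhds
  simp only [Pi.mul_apply] at hd
  have hd' : deriv riemannZeta (1 - z) = -_ := neg_eq_iff_eq_neg.1 hd
  rw [hd', hv, hlog]
  field_simp
  ring

theorem deriv_factorialPi_div {z : ℂ} (hz : ∀ n : ℤ, z ≠ n) :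
    deriv factorialPi z / factorialPi z = deriv Complex.Gamma z / Complex.Gamma z + z⁻¹ := by
  have h := Complex.digamma_apply_add_one z fun m => by simpa using hz (-m)
  rw [Complex.digamma_def, logDeriv_apply, logDeriv_apply] at h
  rw [← h]
  unfold factorialPi
  rw [deriv_comp_add_const]

/-- The reflection formula of the digamma function in disguise, deduced from the oddness of the sum
of the two series and from `Π'/Π (-z) = Γ'/Γ (1 - z)`. -/
theorem two_mul_pi_mul_cot_add_digamma {z : ℂ} (hz : ∀ n : ℤ, z ≠ n) (hre : |z.re| < 1) :
    z * (deriv factorialPi z / factorialPi z) -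
      z * (deriv Complex.Gamma (1 - z) / Complex.Gamma (1 - z)) +
      Real.pi * z * (Complex.cos (Real.pi * z) / Complex.sin (Real.pi * z)) = 1 := by
  obtain ⟨η, h1, h2⟩ := exists_between hre
  have hη : η < |(1 : ℂ).re| := by simpa using h2
  have hmem : z ∈ obliqueStrip 1 η := by simpa [obliqueStrip] using h1
  have hδ : 0 < (|(1 : ℂ).re| - η) / ‖(1 : ℂ)‖ := by simpa using h2
  have hodd := (separatedFromInts_of_mem_obliqueStrip one_ne_zero
    hmem).digammaSeries_add_cotSeries_neg hδ
  have e1 := digamma_eq_digammaSeries hη hmem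
  have e2 := digamma_eq_digammaSeries hη (neg_mem_obliqueStrip hmem)
  have e3 := pi_mul_cot_eq_cotSeries (w := z) (by
    rintro ⟨k, hk⟩
    exact hz k hk.symm)
  have e4 : deriv factorialPi (-z) / factorialPi (-z) =
      deriv Complex.Gamma (1 - z) / Complex.Gamma (1 - z) := by
    unfold factorialPi
    rw [deriv_comp_add_const, neg_add_eq_sub]
  rw [← e4, e1, e2]
  rw [cotSeries_neg] at hodd
  linear_combination 2 * e3 + z ^ 2 * hodd

/-- Average of the differentiated functional equation at `z` and at `1 - z`. The half-angle terms
combine by `tan + cot = 2 / sin`. With `Ψ = Γ'/Γ`, the mean of `Ψ (z)` and `Ψ (1 - z)` differs from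
`z Ψ (z) + (1 - z) Ψ (1 - z)` by `(1/2 - z) (Ψ (1 - z) - Ψ (z)) = (1/2 - z) π cot (π z)`, which the
paired cotangent terms compensate. The `2` is `z · z⁻¹ + (1 - z) (1 - z)⁻¹`, from passing between
`Π'/Π` and `Ψ`. -/
theorem logDeriv_riemannZeta_pair {z : ℂ} (hz : ∀ n : ℤ, z ≠ n) (hre : |z.re| < 1)
    (hζ : riemannZeta z ≠ 0) (hζ' : riemannZeta (1 - z) ≠ 0) :
    deriv riemannZeta z / riemannZeta z + deriv riemannZeta (1 - z) / riemannZeta (1 - z) =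
      2 + Real.log (2 * Real.pi) + Real.pi / 2 / Complex.sin (Real.pi * z) -
      (z * (deriv factorialPi z / factorialPi z) +
        (1 - z) * (deriv factorialPi (1 - z) / factorialPi (1 - z))) -
      (Real.pi * z / 2 * (Complex.cos (Real.pi * z) / Complex.sin (Real.pi * z)) +
        Real.pi * (1 - z) / 2 *
          (Complex.cos (Real.pi * (1 - z)) / Complex.sin (Real.pi * (1 - z)))) := by
  have hz' : ∀ n : ℤ, 1 - z ≠ n := fun n h => hz (1 - n) (by push_cast; rw [← h]; ring)
  have hpi : (Real.pi : ℂ) ≠ 0 := by exact_mod_cast Real.pi_ne_zero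
  have hz0 : z ≠ 0 := by simpa using hz 0
  have hz0' : 1 - z ≠ 0 := by simpa using hz' 0
  have hsin : Complex.sin (Real.pi * z) ≠ 0 := by
    rw [Ne, Complex.sin_eq_zero_iff]
    rintro ⟨k, hk⟩
    exact hz k (mul_left_cancel₀ hpi (by rw [hk]; ring))
  have a1 := logDeriv_riemannZeta_one_sub hz hζ
  have a2 := logDeriv_riemannZeta_one_sub hz' hζ'
  rw [sub_sub_cancel] at a2
  have b1 := deriv_factorialPi_div hz
  have b2 := deriv_factorialPi_div hz'
  have c1 := two_mul_pi_mul_cot_add_digamma hz hre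
  have s1 : Complex.sin (Real.pi * (1 - z) / 2) = Complex.cos (Real.pi * z / 2) := by
    rw [show (Real.pi : ℂ) * (1 - z) / 2 = Real.pi / 2 - Real.pi * z / 2 by ring,
      Complex.sin_pi_div_two_sub]
  have s2 : Complex.cos (Real.pi * (1 - z) / 2) = Complex.sin (Real.pi * z / 2) := by
    rw [show (Real.pi : ℂ) * (1 - z) / 2 = Real.pi / 2 - Real.pi * z / 2 by ring,
      Complex.cos_pi_div_two_sub]
  have s3 : Complex.sin (Real.pi * (1 - z)) = Complex.sin (Real.pi * z) := by
    rw [mul_sub, mul_one, Complex.sin_pi_sub]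
  have s4 : Complex.cos (Real.pi * (1 - z)) = -Complex.cos (Real.pi * z) := by
    rw [mul_sub, mul_one, Complex.cos_pi_sub]
  have s5 : Complex.sin (Real.pi * z) =
      2 * Complex.sin (Real.pi * z / 2) * Complex.cos (Real.pi * z / 2) := by
    rw [← Complex.sin_two_mul]; congr 1; ring
  have htan : Complex.sin (Real.pi * z / 2) / Complex.cos (Real.pi * z / 2) +
      Complex.cos (Real.pi * z / 2) / Complex.sin (Real.pi * z / 2) =
      2 / Complex.sin (Real.pi * z) := by
    rw [s5] at hsin ⊢
    have h1 : Complex.sin (Real.pi * z / 2) ≠ 0 := fun h => hsin (by rw [h]; ring)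
    have h2 : Complex.cos (Real.pi * z / 2) ≠ 0 := fun h => hsin (by rw [h]; ring)
    have := Complex.sin_sq_add_cos_sq (Real.pi * z / 2)
    field_simp
    linear_combination this
  rw [s1, s2] at a2
  rw [s3, s4]
  rw [b1] at c1 ⊢
  rw [b2]
  have i1 : z * z⁻¹ = 1 := mul_inv_cancel₀ hz0
  have i2 : (1 - z) * (1 - z)⁻¹ = 1 := mul_inv_cancel₀ hz0'
  set Ψ := deriv Complex.Gamma z / Complex.Gamma z
  set Ψ' := deriv Complex.Gamma (1 - z) / Complex.Gamma (1 - z)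
  set ct := Complex.cos (Real.pi * z) / Complex.sin (Real.pi * z) with hct
  have hct' : -Complex.cos (Real.pi * z) / Complex.sin (Real.pi * z) = -ct := by
    rw [neg_div]
  rw [hct']
  have c2 : Ψ' = Ψ + Real.pi * ct := by
    refine mul_left_cancel₀ hz0 ?_
    linear_combination i1 - c1
  linear_combination (1 / 2 : ℂ) * a1 + (1 / 2 : ℂ) * a2 + (Real.pi / 4 : ℂ) * htan + i1 + i2 +
    (1 / 2 - z) * c2

/-! ### Calculus of Bernoulli values and the value of `ζ'/ζ` -/

theorem HasBernoulliValue.add {f g : ℂ → ℂ} {u v : ℂ} (hf : HasBernoulliValue f u)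
    (hg : HasBernoulliValue g v) : HasBernoulliValue (fun z => f z + g z) (u + v) := by
  have e : (fun t : ℝ => ((f (1 / 2 + t * I) + g (1 / 2 + t * I)) +
      (f (1 / 2 - t * I) + g (1 / 2 - t * I))) * (bernoulliDensity t : ℂ)) = fun t : ℝ =>
      (f (1 / 2 + t * I) + f (1 / 2 - t * I)) * (bernoulliDensity t : ℂ) +
        (g (1 / 2 + t * I) + g (1 / 2 - t * I)) * (bernoulliDensity t : ℂ) := by
    ext t; ring
  unfold HasBernoulliValue
  rw [e]
  exact ⟨hf.1.add hg.1, by rw [integral_add hf.1 hg.1, hf.2, hg.2]⟩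

theorem HasBernoulliValue.const_mul {f : ℂ → ℂ} {u : ℂ} (hf : HasBernoulliValue f u) (c : ℂ) :
    HasBernoulliValue (fun z => c * f z) (c * u) := by
  have e : (fun t : ℝ => (c * f (1 / 2 + t * I) + c * f (1 / 2 - t * I)) *
      (bernoulliDensity t : ℂ)) = fun t : ℝ =>
      c * ((f (1 / 2 + t * I) + f (1 / 2 - t * I)) * (bernoulliDensity t : ℂ)) := by
    ext t; ring
  unfold HasBernoulliValue
  rw [e]
  exact ⟨hf.1.const_mul c, by rw [integral_const_mul, hf.2]⟩

/-- Only the paired sums are compared, so `g` may have poles on the line that cancel between `z` and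
`1 - z`, as for `ζ'/ζ`. -/
theorem HasBernoulliValue.congr_ae {f g : ℂ → ℂ} {u : ℂ} (hf : HasBernoulliValue f u)
    (h : ∀ᵐ t : ℝ, f (1 / 2 + t * I) + f (1 / 2 - t * I) =
      g (1 / 2 + t * I) + g (1 / 2 - t * I)) : HasBernoulliValue g u := by
  have h' : (fun t : ℝ => (f (1 / 2 + t * I) + f (1 / 2 - t * I)) * (bernoulliDensity t : ℂ))
      =ᵐ[volume.restrict (Ioi 0)]
      fun t : ℝ => (g (1 / 2 + t * I) + g (1 / 2 - t * I)) * (bernoulliDensity t : ℂ) := by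
    filter_upwards [ae_restrict_of_ae h] with t ht
    rw [ht]
  exact ⟨hf.1.congr h', by rw [← integral_congr_ae h', hf.2]⟩

theorem hasBernoulliValue_inv_sin :
    HasBernoulliValue (fun z => Real.pi / 4 / Complex.sin (Real.pi * z))
      ((Real.pi : ℂ) ^ 2 / 16) := by
  obtain ⟨hi, he⟩ := integral_inv_cosh_mul_bernoulliDensity
  have e : (fun t : ℝ => (Real.pi / 4 / Complex.sin (Real.pi * (1 / 2 + t * I)) +
      Real.pi / 4 / Complex.sin (Real.pi * (1 / 2 - t * I))) * (bernoulliDensity t : ℂ)) =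
      fun t : ℝ => ((Real.pi / 2 / Real.cosh (Real.pi * t) * bernoulliDensity t : ℝ) : ℂ) := by
    ext t
    have e1 : (1 / 2 - t * I : ℂ) = 1 / 2 + ((-t : ℝ) : ℂ) * I := by push_cast; ring
    rw [e1, sin_pi_mul_half_add, sin_pi_mul_half_add]
    push_cast
    rw [mul_neg, Complex.cosh_neg]
    ring
  unfold HasBernoulliValue
  rw [e]
  refine ⟨hi.ofReal, ?_⟩
  rw [integral_complex_ofReal, he]
  push_cast
  rfl

theorem hasBernoulliValue_logDeriv_riemannZeta :
    HasBernoulliValue (fun z => deriv riemannZeta z / riemannZeta z)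
      ((1 + (Real.eulerMascheroniConstant : ℂ) + (Real.log (2 * Real.pi) : ℂ)) / 2
          + (Real.pi : ℂ) ^ 2 / 16) := by
  have hP := hasBernoulliFamily_mul_digamma.hasBernoulliValue 1 (by simp)
  have hC := hasBernoulliFamily_pi_mul_cot.hasBernoulliValue 1 (by simp)
  have h1 := hasBernoulliValue_pow 0
  simp only [pow_zero, mul_one, bernoulli'_zero, Rat.cast_one] at hP hC h1
  -- A summand symmetric under `z ↦ 1 - z` is counted twice by the pairing, so the constant and the
  -- `1 / sin` term enter with half their coefficients in `logDeriv_riemannZeta_pair`.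
  have hsum := (((h1.const_mul ((2 + Real.log (2 * Real.pi)) / 2)).add
    hasBernoulliValue_inv_sin).add (hP.const_mul (-1))).add (hC.const_mul (-1))
  have hval := hsum.congr_ae (g := fun z => deriv riemannZeta z / riemannZeta z) ?_
  · convert hval using 1
    rw [digammaValue, cotValue_one]
    ring
  · have hζ2 : ∀ᵐ t : ℝ, riemannZeta (1 / 2 + ((-t : ℝ) : ℂ) * I) ≠ 0 :=
      (Measure.measurePreserving_neg volume).quasiMeasurePreserving.ae ae_riemannZeta_ne_zero
    filter_upwards [ae_riemannZeta_ne_zero, hζ2] with t ht ht'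
    set z : ℂ := 1 / 2 + t * I with hz
    have hz' : (1 / 2 - t * I : ℂ) = 1 - z := by rw [hz]; ring
    have hz'' : (1 / 2 + ((-t : ℝ) : ℂ) * I : ℂ) = 1 - z := by rw [hz]; push_cast; ring
    rw [hz''] at ht'
    have hre : z.re = 1 / 2 := by simp [hz]
    have hint : ∀ n : ℤ, z ≠ n := by
      intro n hn
      rw [hn, Complex.intCast_re] at hre
      have h2 : (2 * n : ℝ) = 1 := by linarith
      have h3 : 2 * n = 1 := by exact_mod_cast h2
      omega
    have hpair := logDeriv_riemannZeta_pair hint (by rw [hre]; norm_num) ht ht'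
    have hsin : Complex.sin (Real.pi * (1 - z)) = Complex.sin (Real.pi * z) := by
      rw [mul_sub, mul_one, Complex.sin_pi_sub]
    rw [hz', hpair, hsin]
    ring

end BernoulliOperator

/-! ### The corollary -/

theorem corollary6p11 :
    ∃ (Z : ℂ) (P C : ℂ → ℂ),
      BernoulliOperator.HasBernoulliValue (fun z => deriv riemannZeta z / riemannZeta z) Z ∧
      BernoulliOperator.HasBernoulliFamily
        (fun w => w * (deriv BernoulliOperator.factorialPi w / BernoulliOperator.factorialPi w))
        P ∧
      BernoulliOperator.HasBernoulliFamily
        (fun w => (Real.pi : ℂ) * w / 2 *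
          (Complex.cos ((Real.pi : ℂ) * w) / Complex.sin ((Real.pi : ℂ) * w))) C ∧
      (∀ s : ℂ, s.re ≠ 0 →
        -s * Z = P s - (1 + s + s * (Real.log (2 * Real.pi) : ℂ)) / 2 + C s
          - (Real.pi : ℂ) ^ 2 / 16 * s) ∧
      P 1 = 1 / 4 - (Real.eulerMascheroniConstant : ℂ) / 2 ∧
      C 1 = 1 / 4 ∧
      Z = (1 + (Real.eulerMascheroniConstant : ℂ) + (Real.log (2 * Real.pi) : ℂ)) / 2
          + (Real.pi : ℂ) ^ 2 / 16 := by
  -- With these witnesses `P s + C s = 1/2 - γ s / 2` is built into `digammaValue`, so the identity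
  -- in `s` is pure algebra.
  refine ⟨_, BernoulliOperator.digammaValue, BernoulliOperator.cotValue,
    BernoulliOperator.hasBernoulliValue_logDeriv_riemannZeta,
    BernoulliOperator.hasBernoulliFamily_mul_digamma,
    BernoulliOperator.hasBernoulliFamily_pi_mul_cot, fun s _ => ?_, ?_,
    BernoulliOperator.cotValue_one, rfl⟩
  · rw [BernoulliOperator.digammaValue]
    ring
  · rw [BernoulliOperator.digammaValue, BernoulliOperator.cotValue_one]
    ring
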